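/- Let $\bar n>0$ and let $\nu(dw)=e^{-w}\bigl(\ln(1+e^{w})\bigr)^{5/2}\,dw$ on $\mathbb R$. For $u\neq v$ put $$\overline K_3(u,v)=4\bar n\,\bigl[\ln(1+e^u)\ln(1+e^v)\bigr]^{-3/2}\,\frac{e^{-|u-v|}}{1+e^{-\min(u,v)}+e^{-\max(u,v)}}\;\frac{2+e^{\max(u,v)}}{1-e^{-|u-v|}},$$ and, for $\varepsilon_0,\mu',\gamma_0,a_1>0$, $$\overline K_3^{\varepsilon}(u,v)=\overline K_3(u,v)\,\frac{1-e^{-\min(\varepsilon(u,v),|u-v|)}}{1-e^{-\varepsilon(u,v)}},\qquad \varepsilon(u,v)=\varepsilon_0\exp\Bigl(-\tfrac{\mu'}{\gamma_0}\max(a_1,\max(u,v))\Bigr).$$ Let $0<\alpha\le 1$. For $K=\overline K_3$ or $K=\overline K_3^{\varepsilon}$ consider, in the complex Hilbert space $L^2(\nu)$, the operator $$(T\psi)(u)=\int_{\mathbb R}\nu(dv)\,K(u,v)\,\bigl(\psi(u)-\psi(v)\bigr)$$ whose domain is the space $C_c^{0,\alpha}(\mathbb R)$ of compactly supported $\alpha$-Hölder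 continuous functions. Then $T$ is densely defined, symmetric and non-negative. Let $\overline L_3$ (for $K=\overline K_3$) and $\overline L_3^{\varepsilon}$ (for $K=\overline K_3^{\varepsilon}$) be its Friedrichs extension, that is, the restriction of the adjoint $T^*$ to those $\psi\in D(T^*)$ for which there are $\varphi_k\in D(T)$ with $\varphi_k\to\psi$ in $L^2(\nu)$ and $(\varphi_k-\varphi_m,T(\varphi_k-\varphi_m))\to 0$ as $k,m\to\infty$. Each of the operators $L=\overline L_3$ and $L=\overline L_3^{\varepsilon}$ (for all $\varepsilon_0,\mu',\gamma_0,a_1>0$) is self-adjoint and non-negative, and its kernel $\{\psi\in D(L): L\psi=0\}$ consists exactly of the ($\nu$-almost everywhere) constant functions. Each has a spectral gap: there is $\delta>0$ (which may depend on the operator) with $\sigma(L)\subset\{0\}\cup[\delta,\infty)$. Finally, each generates a contraction semigroup: there is a strongly continuous semigroup $(S_t)_{t\ge0}$ on $L^2(\nu)$ with $\|S_t\|\le 1$ whose infinitesimal generator is $-L$, i.e. $S_t=e^{-tL}$. -/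

import Mathlib

open MeasureTheory Filter Topology
open scoped NNReal ENNReal

noncomputable section

namespace ThreeWave

/-- The function `u ↦ ln (1 + e^u)`. -/
def softplus (u : ℝ) : ℝ := Real.log (1 + Real.exp u)

/-- The density `e^{-w} (ln (1 + e^w))^{5/2}` of the weight with respect to Lebesgue measure. -/
def nuDensity (w : ℝ) : ℝ := Real.exp (-w) * softplus w ^ (5 / 2 : ℝ)

/-- The weight `ν(dw) = e^{-w} (ln (1 + e^w))^{5/2} dw` on the real line. -/
def nu : Measure ℝ := volume.withDensity fun w => ENNReal.ofReal (nuDensity w)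

/-- The kernel of the linearized operator; `n` is the condensate density. -/
def kernel (n u v : ℝ) : ℝ :=
  4 * n * (softplus u * softplus v) ^ (-(3 / 2) : ℝ) *
    (Real.exp (-|u - v|) / (1 + Real.exp (-min u v) + Real.exp (-max u v))) *
    ((2 + Real.exp (max u v)) / (1 - Real.exp (-|u - v|)))

/-- The cut-off scale `ε(u, v) = ε₀ exp (-(μ' / γ₀) max (a₁, max (u, v)))`. -/
def cutoff (ε₀ μ' γ₀ a₁ u v : ℝ) : ℝ :=
  ε₀ * Real.exp (-(μ' / γ₀) * max a₁ (max u v))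

/-- The regularized kernel. -/
def kernelReg (n ε₀ μ' γ₀ a₁ u v : ℝ) : ℝ :=
  kernel n u v *
    ((1 - Real.exp (-min (cutoff ε₀ μ' γ₀ a₁ u v) |u - v|)) /
      (1 - Real.exp (-cutoff ε₀ μ' γ₀ a₁ u v)))

lemma softplus_pos (u : ℝ) : 0 < softplus u :=
  Real.log_pos (by linarith [Real.exp_pos u])

lemma softplus_mono {u v : ℝ} (h : u ≤ v) : softplus u ≤ softplus v := by
  unfold softplus
  gcongr

lemma softplus_le (u : ℝ) : softplus u ≤ Real.exp u := by
  have := Real.log_le_sub_one_of_pos (x := 1 + Real.exp u) (by positivity)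
  unfold softplus; linarith

lemma softplus_le_half (u : ℝ) : softplus u ≤ 2 * Real.exp (u / 2) := by
  have h1 : 1 + Real.exp u ≤ (1 + Real.exp (u / 2)) ^ 2 := by
    have : Real.exp u = Real.exp (u / 2) ^ 2 := by rw [← Real.exp_nat_mul]; congr 1; push_cast; ring
    rw [this]; nlinarith [Real.exp_pos (u / 2)]
  calc softplus u ≤ Real.log ((1 + Real.exp (u / 2)) ^ 2) := by unfold softplus; gcongr
    _ = 2 * softplus (u / 2) := by rw [Real.log_pow]; simp [softplus]
    _ ≤ 2 * Real.exp (u / 2) := by linarith [softplus_le (u / 2)]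

lemma softplus_le_quarter (u : ℝ) : softplus u ≤ 4 * Real.exp (u / 4) := by
  have h1 : 1 + Real.exp u ≤ (1 + Real.exp (u / 4)) ^ 4 := by
    have : Real.exp u = Real.exp (u / 4) ^ 4 := by rw [← Real.exp_nat_mul]; congr 1; push_cast; ring
    have h := Real.exp_pos (u / 4)
    rw [this]
    have : 0 ≤ 4 * Real.exp (u / 4) + 6 * Real.exp (u / 4) ^ 2 + 4 * Real.exp (u / 4) ^ 3 := by
      positivity
    linarith [this, show (1 + Real.exp (u / 4)) ^ 4 = 1 + 4 * Real.exp (u / 4) +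
      6 * Real.exp (u / 4) ^ 2 + 4 * Real.exp (u / 4) ^ 3 + Real.exp (u / 4) ^ 4 by ring]
  calc softplus u ≤ Real.log ((1 + Real.exp (u / 4)) ^ 4) := by unfold softplus; gcongr
    _ = 4 * softplus (u / 4) := by rw [Real.log_pow]; simp [softplus]
    _ ≤ 4 * Real.exp (u / 4) := by linarith [softplus_le (u / 4)]

lemma le_softplus (u : ℝ) : Real.exp u / (1 + Real.exp u) ≤ softplus u := by
  have h := Real.one_sub_inv_le_log_of_pos (x := 1 + Real.exp u) (by positivity)
  have : Real.exp u / (1 + Real.exp u) = 1 - (1 + Real.exp u)⁻¹ := by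
    have : (1 + Real.exp u) ≠ 0 := by positivity
    field_simp; ring
  rw [this]; exact h

lemma measurable_softplus : Measurable softplus := by
  unfold softplus; fun_prop

lemma measurable_nuDensity : Measurable nuDensity := by
  have := measurable_softplus
  unfold nuDensity; fun_prop

lemma nuDensity_nonneg (w : ℝ) : 0 ≤ nuDensity w :=
  mul_nonneg (Real.exp_pos _).le (Real.rpow_nonneg (softplus_pos w).le _)

lemma measurable_kernel (n : ℝ) : Measurable (Function.uncurry (kernel n)) := by
  have := measurable_softplus
  unfold Function.uncurry kernel
  fun_prop

lemma measurable_kernel_right (n u : ℝ) : Measurable fun v => kernel n u v := by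
  have := measurable_softplus
  unfold kernel
  fun_prop

lemma measurable_kernelReg (n ε₀ μ' γ₀ a₁ : ℝ) :
    Measurable (Function.uncurry (kernelReg n ε₀ μ' γ₀ a₁)) := by
  have h := measurable_kernel n
  have h2 : Measurable fun p : ℝ × ℝ => (1 - Real.exp (-min (cutoff ε₀ μ' γ₀ a₁ p.1 p.2) |p.1 - p.2|)) /
      (1 - Real.exp (-cutoff ε₀ μ' γ₀ a₁ p.1 p.2)) := by
    unfold cutoff; fun_prop
  exact h.mul h2

lemma kernel_nonneg {n : ℝ} (hn : 0 ≤ n) (u v : ℝ) : 0 ≤ kernel n u v := by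
  have h1 : Real.exp (-|u - v|) ≤ 1 := Real.exp_le_one_iff.2 (by simp)
  have h2 := softplus_pos u
  have h3 := softplus_pos v
  have h4 : 0 ≤ 1 - Real.exp (-|u - v|) := by linarith
  unfold kernel
  positivity

lemma abs_kernel (n u v : ℝ) : |kernel n u v| = |n| * kernel 1 u v := by
  have : kernel n u v = n * kernel 1 u v := by unfold kernel; ring
  rw [this, abs_mul, abs_of_nonneg (kernel_nonneg zero_le_one u v)]

lemma abs_kernelReg_le (n ε₀ μ' γ₀ a₁ u v : ℝ) :
    |kernelReg n ε₀ μ' γ₀ a₁ u v| ≤ |n| * kernel 1 u v := by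
  unfold kernelReg
  rw [abs_mul, abs_kernel]
  refine mul_le_of_le_one_right (mul_nonneg (abs_nonneg _) (kernel_nonneg zero_le_one u v)) ?_
  generalize cutoff ε₀ μ' γ₀ a₁ u v = e
  have hr := abs_nonneg (u - v)
  generalize |u - v| = r at hr
  rcases le_or_gt e r with h | h
  · rw [min_eq_left h, abs_div]; exact div_self_le_one _
  · rw [min_eq_right h.le, abs_div]
    have h1 : Real.exp (-r) ≤ 1 := Real.exp_le_one_iff.2 (by linarith)
    have h2 : Real.exp (-e) ≤ Real.exp (-r) := by gcongr
    rw [abs_of_nonneg (by linarith), abs_of_nonneg (by linarith)]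
    exact div_le_one_of_le₀ (by linarith) (by linarith)

lemma integrable_comp_abs_of {f : ℝ → ℝ} (hf : IntegrableOn f (Set.Ioi 0)) :
    Integrable fun x => f |x| := by
  have h1 : IntegrableOn (fun x => f |x|) (Set.Ioi 0) :=
    hf.congr_fun (fun x hx => by simp [abs_of_pos (Set.mem_Ioi.1 hx)]) measurableSet_Ioi
  have h2 : IntegrableOn (fun x => f |x|) (Set.Iio 0) := by
    have := h1.comp_neg
    simpa using this
  have h3 : IntegrableOn (fun x => f |x|) (Set.Iic 0) := by
    rwa [integrableOn_Iic_iff_integrableOn_Iio]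
  rw [← integrableOn_univ, ← Set.Iic_union_Ioi (a := (0 : ℝ))]
  exact h3.union h1

lemma integrable_exp_neg_mul_abs {b : ℝ} (hb : 0 < b) :
    Integrable fun x : ℝ => Real.exp (-b * |x|) :=
  integrable_comp_abs_of (f := fun x => Real.exp (-b * x)) (exp_neg_integrableOn_Ioi 0 hb)

lemma integrable_singular {a : ℝ} (ha : 0 < a) :
    Integrable fun x : ℝ => if |x| < 1 then |x| ^ (a - 1) else 0 := by
  refine integrable_comp_abs_of (f := fun x => if x < 1 then x ^ (a - 1) else 0) ?_
  have h : IntegrableOn (fun x : ℝ => x ^ (a - 1)) (Set.Ioo 0 1) :=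
    (intervalIntegral.integrableOn_Ioo_rpow_iff one_pos).2 (by linarith)
  have h2 := h.integrable_indicator measurableSet_Ioo
  refine h2.integrableOn.congr_fun (fun x hx => ?_) measurableSet_Ioi
  simp only [Set.indicator, Set.mem_Ioo, Set.mem_Ioi.1 hx, true_and]

lemma nuDensity_le (w : ℝ) : nuDensity w ≤ 32 * Real.exp (-(3 / 8) * |w|) := by
  have hp := softplus_pos w
  unfold nuDensity
  rcases le_total 0 w with h | h
  · rw [abs_of_nonneg h]
    have h1 : softplus w ^ (5 / 2 : ℝ) ≤ (4 * Real.exp (w / 4)) ^ (5 / 2 : ℝ) :=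
      Real.rpow_le_rpow hp.le (softplus_le_quarter w) (by norm_num)
    have h4 : (4 : ℝ) ^ (5 / 2 : ℝ) = 32 := by
      rw [show (4 : ℝ) = 2 ^ (2 : ℝ) by norm_num, ← Real.rpow_mul (by norm_num)]; norm_num
    rw [Real.mul_rpow (by norm_num) (Real.exp_pos _).le, h4, ← Real.exp_mul] at h1
    calc _ ≤ Real.exp (-w) * (32 * Real.exp (w / 4 * (5 / 2))) := by gcongr
      _ = 32 * (Real.exp (-w) * Real.exp (w / 4 * (5 / 2))) := by ring
      _ = _ := by rw [← Real.exp_add]; ring_nf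
  · rw [abs_of_nonpos h]
    have h1 : softplus w ^ (5 / 2 : ℝ) ≤ (Real.exp w) ^ (5 / 2 : ℝ) :=
      Real.rpow_le_rpow hp.le (softplus_le w) (by norm_num)
    rw [← Real.exp_mul] at h1
    calc _ ≤ Real.exp (-w) * Real.exp (w * (5 / 2)) := by gcongr
      _ = Real.exp (-w + w * (5 / 2)) := by rw [Real.exp_add]
      _ ≤ Real.exp (-(3 / 8) * -w) := by gcongr; linarith
      _ ≤ _ := by linarith [Real.exp_pos (-(3 / 8) * -w)]

instance : IsFiniteMeasure nu := by
  refine isFiniteMeasure_withDensity_ofReal (Integrable.hasFiniteIntegral ?_)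
  refine ((integrable_exp_neg_mul_abs (b := 3 / 8) (by norm_num)).const_mul 32).mono'
    measurable_nuDensity.aestronglyMeasurable (ae_of_all _ fun w => ?_)
  rw [Real.norm_of_nonneg (nuDensity_nonneg w)]
  exact nuDensity_le w

/-- The kernel density `ν(v) K(u, v)` for unit condensate density without its line singularity. -/
def regPart (u v : ℝ) : ℝ :=
  softplus u ^ (-(3 / 2) : ℝ) * (softplus v * Real.exp (-v)) *
    (Real.exp (-|u - v|) * (2 + Real.exp (max u v)) /
      (1 + Real.exp (-min u v) + Real.exp (-max u v)))

lemma nuDensity_mul_kernel (u v : ℝ) :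
    nuDensity v * kernel 1 u v = 4 * regPart u v / (1 - Real.exp (-|u - v|)) := by
  have hu := softplus_pos u
  have hv := softplus_pos v
  have h : softplus v ^ (5 / 2 : ℝ) * softplus v ^ (-(3 / 2) : ℝ) = softplus v := by
    rw [← Real.rpow_add hv]; norm_num
  unfold nuDensity kernel regPart
  rw [Real.mul_rpow hu.le hv.le]
  calc _ = 4 * (softplus u ^ (-(3 / 2) : ℝ) *
        ((softplus v ^ (5 / 2 : ℝ) * softplus v ^ (-(3 / 2) : ℝ)) * Real.exp (-v)) *
        (Real.exp (-|u - v|) * (2 + Real.exp (max u v)) /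
      (1 + Real.exp (-min u v) + Real.exp (-max u v)))) / (1 - Real.exp (-|u - v|)) := by ring
    _ = _ := by rw [h]

lemma regPart_nonneg (u v : ℝ) : 0 ≤ regPart u v := by
  have := softplus_pos u
  have := softplus_pos v
  unfold regPart; positivity

lemma exists_regPart_le (R : ℝ) (hR : 0 ≤ R) : ∃ c, 0 ≤ c ∧ ∀ u v,
    (|u| ≤ R → regPart u v ≤ c * Real.exp (-(1 / 2) * |u - v|)) ∧ (|v| ≤ R → regPart u v ≤ c) := by
  have hl := softplus_pos (-R)
  set l := softplus (-R) ^ (-(3 / 2) : ℝ) with hl_def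
  have hl0 : 0 ≤ l := by positivity
  have hE : 1 ≤ Real.exp R := Real.one_le_exp hR
  have hlow : ∀ u, -R ≤ u → softplus u ^ (-(3 / 2) : ℝ) ≤ l := fun u hu =>
    Real.rpow_le_rpow_of_nonpos hl (softplus_mono hu) (by norm_num)
  have hs1 : ∀ v, softplus v * Real.exp (-v) ≤ 1 := fun v => by
    have h := softplus_le v
    calc _ ≤ Real.exp v * Real.exp (-v) := by gcongr
      _ = 1 := by rw [← Real.exp_add]; simp
  set d := (1 + Real.exp R) ^ (3 / 2 : ℝ) with hd_def
  have hd0 : 0 ≤ d := by positivity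
  have hdu : ∀ u, u ≤ R → softplus u ^ (-(3 / 2) : ℝ) ≤ d * Real.exp (-(3 / 2) * u) := by
    intro u hu
    have h1 : Real.exp u / (1 + Real.exp R) ≤ softplus u := by
      refine le_trans ?_ (le_softplus u)
      gcongr
    have h2 := Real.rpow_le_rpow_of_nonpos (by positivity) h1 (show (-(3 / 2) : ℝ) ≤ 0 by norm_num)
    rw [Real.div_rpow (by positivity) (by positivity), ← Real.exp_mul,
      Real.rpow_neg (x := 1 + Real.exp R) (by positivity), div_inv_eq_mul] at h2
    rw [show -(3 / 2) * u = u * -(3 / 2) by ring]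
    linarith
  have hden : ∀ u v : ℝ, 1 ≤ 1 + Real.exp (-min u v) + Real.exp (-max u v) := fun u v => by
    linarith [Real.exp_pos (-min u v), Real.exp_pos (-max u v)]
  refine ⟨l * (2 + 2 * Real.exp R) + d * Real.exp (3 * R) * (2 + Real.exp R), by positivity,
    fun u v => ⟨fun hu => ?_, fun hv => ?_⟩⟩
  · have hu' := abs_le.1 hu
    have hq : Real.exp (-|u - v|) * (2 + Real.exp (max u v)) /
      (1 + Real.exp (-min u v) + Real.exp (-max u v)) ≤
        Real.exp (-|u - v|) * (2 + Real.exp (max u v)) := div_le_self (by positivity) (hden u v)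
    have hv0 := softplus_pos v
    have key : (softplus v * Real.exp (-v)) * (Real.exp (-|u - v|) * (2 + Real.exp (max u v))) ≤
        (2 + 2 * Real.exp R) * Real.exp (-(1 / 2) * |u - v|) := by
      have h2 : Real.exp (-|u - v|) ≤ Real.exp (-(1 / 2) * |u - v|) := by
        gcongr; linarith [abs_nonneg (u - v)]
      rcases le_total v u with h | h
      · rw [max_eq_left h]
        calc _ ≤ 1 * (Real.exp (-(1 / 2) * |u - v|) * (2 + Real.exp R)) := by
              gcongr
              · exact hs1 v
              · exact hu'.2
          _ ≤ _ := by nlinarith [Real.exp_pos (-(1 / 2) * |u - v|)]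
      · rw [max_eq_right h]
        have hr : |u - v| = v - u := by rw [abs_sub_comm, abs_of_nonneg (by linarith)]
        have e1 : Real.exp (-|u - v|) * Real.exp v = Real.exp u := by
          rw [hr, ← Real.exp_add]; ring_nf
        have e2 : softplus v * Real.exp (-v) ≤ 2 * Real.exp (-v / 2) := by
          calc _ ≤ 2 * Real.exp (v / 2) * Real.exp (-v) := by gcongr; exact softplus_le_half v
            _ = 2 * Real.exp (-v / 2) := by rw [mul_assoc, ← Real.exp_add]; ring_nf
        have e3 : Real.exp (-v / 2) * Real.exp u = Real.exp (u / 2) * Real.exp (-(1 / 2) * |u - v|) := by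
          rw [hr, ← Real.exp_add, ← Real.exp_add]; ring_nf
        have e4 : Real.exp (u / 2) ≤ Real.exp R := by gcongr; linarith
        calc _ = 2 * (softplus v * Real.exp (-v)) * Real.exp (-|u - v|) +
              (softplus v * Real.exp (-v)) * (Real.exp (-|u - v|) * Real.exp v) := by ring
          _ ≤ 2 * 1 * Real.exp (-(1 / 2) * |u - v|) + (2 * Real.exp (-v / 2)) * Real.exp u := by
              rw [e1]; gcongr; exact hs1 v
          _ = 2 * Real.exp (-(1 / 2) * |u - v|) +
              2 * (Real.exp (u / 2) * Real.exp (-(1 / 2) * |u - v|)) := by rw [← e3]; ring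
          _ ≤ 2 * Real.exp (-(1 / 2) * |u - v|) +
              2 * (Real.exp R * Real.exp (-(1 / 2) * |u - v|)) := by gcongr
          _ = _ := by ring
    calc regPart u v ≤ l * (softplus v * Real.exp (-v)) *
          (Real.exp (-|u - v|) * (2 + Real.exp (max u v))) := by
            unfold regPart; gcongr; exact hlow u hu'.1
      _ = l * ((softplus v * Real.exp (-v)) * (Real.exp (-|u - v|) * (2 + Real.exp (max u v)))) := by
            ring
      _ ≤ l * ((2 + 2 * Real.exp R) * Real.exp (-(1 / 2) * |u - v|)) := by gcongr
      _ = (l * (2 + 2 * Real.exp R)) * Real.exp (-(1 / 2) * |u - v|) := by ring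
      _ ≤ _ := by gcongr; exact le_add_of_nonneg_right (by positivity)
  · have hv' := abs_le.1 hv
    have hu0 := softplus_pos u
    have hv0 := softplus_pos v
    have hq0 : 0 ≤ Real.exp (-|u - v|) * (2 + Real.exp (max u v)) /
      (1 + Real.exp (-min u v) + Real.exp (-max u v)) := by positivity
    rcases le_total v u with h | h
    · have hr : |u - v| = u - v := abs_of_nonneg (by linarith)
      have e0 : Real.exp (-|u - v|) ≤ 1 := Real.exp_le_one_iff.2 (by simp)
      have e1 : Real.exp (-|u - v|) * Real.exp u = Real.exp v := by
        rw [hr, ← Real.exp_add]; ring_nf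
      have e2 : Real.exp v ≤ Real.exp R := by gcongr; exact hv'.2
      have hq : Real.exp (-|u - v|) * (2 + Real.exp (max u v)) /
          (1 + Real.exp (-min u v) + Real.exp (-max u v)) ≤ 2 + 2 * Real.exp R := by
        refine (div_le_self (by positivity) (hden u v)).trans ?_
        rw [max_eq_left h, mul_add, e1]
        nlinarith
      calc regPart u v ≤ l * 1 * (2 + 2 * Real.exp R) := by
            unfold regPart; gcongr
            · exact hlow u (by linarith)
            · exact hs1 v
        _ ≤ _ := by rw [mul_one]; exact le_add_of_nonneg_right (by positivity)
    · have hr : |u - v| = v - u := by rw [abs_sub_comm, abs_of_nonneg (by linarith)]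
      have e1 : Real.exp (-|u - v|) ≤ Real.exp (u + R) := by rw [hr]; gcongr; linarith
      have hq : Real.exp (-|u - v|) * (2 + Real.exp (max u v)) /
          (1 + Real.exp (-min u v) + Real.exp (-max u v)) ≤
          Real.exp (u + R) * (2 + Real.exp R) * Real.exp u := by
        rw [div_le_iff₀ (by positivity), max_eq_right h, min_eq_left h]
        have e3 : 1 ≤ Real.exp u * (1 + Real.exp (-u) + Real.exp (-v)) := by
          have : Real.exp u * Real.exp (-u) = 1 := by rw [← Real.exp_add]; simp
          nlinarith [mul_pos (Real.exp_pos u) (Real.exp_pos (-v)), Real.exp_pos u]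
        calc Real.exp (-|u - v|) * (2 + Real.exp v) ≤ Real.exp (u + R) * (2 + Real.exp R) := by
              gcongr; exact hv'.2
          _ ≤ Real.exp (u + R) * (2 + Real.exp R) *
              (Real.exp u * (1 + Real.exp (-u) + Real.exp (-v))) :=
              le_mul_of_one_le_right (by positivity) e3
          _ = _ := by ring
      calc regPart u v ≤ (d * Real.exp (-(3 / 2) * u)) * 1 *
            (Real.exp (u + R) * (2 + Real.exp R) * Real.exp u) := by
            unfold regPart; gcongr
            · exact hdu u (by linarith)
            · exact hs1 v
        _ = d * (Real.exp (-(3 / 2) * u) * Real.exp (u + R) * Real.exp u) * (2 + Real.exp R) := by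
            ring
        _ = d * Real.exp (u / 2 + R) * (2 + Real.exp R) := by
            rw [← Real.exp_add, ← Real.exp_add]; ring_nf
        _ ≤ d * Real.exp (3 * R) * (2 + Real.exp R) := by gcongr; linarith
        _ ≤ _ := le_add_of_nonneg_left (by positivity)

lemma norm_sub_div_le {g : ℝ → ℂ} {C a : ℝ} {B : ℝ} (hC : 0 ≤ C) (hB0 : 0 ≤ B)
    (hg : ∀ u v, ‖g u - g v‖ ≤ C * |u - v| ^ a) (hB : ∀ u, ‖g u‖ ≤ B) {u v : ℝ} (huv : u ≠ v) :
    ‖g u - g v‖ / (1 - Real.exp (-|u - v|)) ≤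
      (2 * C + 4 * B) * ((if |v - u| < 1 then |v - u| ^ (a - 1) else 0) + 1) := by
  rw [abs_sub_comm v u]
  have hr : 0 < |u - v| := abs_pos.2 (sub_ne_zero.2 huv)
  have h1 := hg u v
  have h2 : ‖g u - g v‖ ≤ 2 * B := (norm_sub_le _ _).trans (by linarith [hB u, hB v])
  generalize |u - v| = r at *
  have h3 : r / (1 + r) ≤ 1 - Real.exp (-r) := by
    have : Real.exp (-r) ≤ 1 / (1 + r) := by
      rw [Real.exp_neg, inv_eq_one_div]
      gcongr
      linarith [Real.add_one_le_exp r]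
    have e : r / (1 + r) = 1 - 1 / (1 + r) := by field_simp; ring
    linarith
  have h0 : 0 < r / (1 + r) := by positivity
  split_ifs with h
  · have h4 : r / 2 ≤ 1 - Real.exp (-r) := le_trans (by gcongr; linarith) h3
    calc _ ≤ (C * r ^ a) / (r / 2) := by gcongr
      _ = 2 * C * r ^ (a - 1) := by rw [Real.rpow_sub_one hr.ne']; field_simp
      _ ≤ _ := by
        have : 0 ≤ r ^ (a - 1) := by positivity
        nlinarith [mul_nonneg hB0 this]
  · have h4 : 1 / 2 ≤ 1 - Real.exp (-r) := by
      refine le_trans ?_ h3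
      rw [div_le_div_iff₀ (by norm_num) (by positivity)]; linarith [not_lt.1 h]
    calc _ ≤ (2 * B) / (1 / 2) := by gcongr
      _ ≤ _ := by linarith

/-- The space `C_c^{0,α}` of compactly supported `α`-Hölder continuous functions. -/
def IsHolderCc (α : ℝ≥0) (g : ℝ → ℂ) : Prop := MemHolder α g ∧ HasCompactSupport g

lemma exists_pointwise_le {α : ℝ≥0} (hα : 0 < α) {g : ℝ → ℂ} (hg : IsHolderCc α g) :
    ∃ A R : ℝ, 0 ≤ A ∧ ∀ u v, nuDensity v * kernel 1 u v * ‖g u - g v‖ ≤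
      A * ((2 * (if |v - u| < 1 then |v - u| ^ ((α : ℝ) - 1) else 0) +
        Real.exp (-(1 / 2) * |v - u|)) + (Set.Icc (-R) R).indicator (fun _ => 1) v) := by
  obtain ⟨⟨C, hC⟩, hsupp⟩ := hg
  have hcont : Continuous g := hC.continuous hα
  obtain ⟨B, hB⟩ := hcont.bounded_above_of_compact_support hsupp
  have hB0 : 0 ≤ B := (norm_nonneg _).trans (hB 0)
  obtain ⟨R', hR'⟩ := hsupp.isCompact.isBounded.subset_closedBall (0 : ℝ)
  obtain ⟨R, hRR, hR0⟩ : ∃ R, R' ≤ R ∧ 0 ≤ R := ⟨max R' 0, le_max_left _ _, le_max_right _ _⟩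
  have hzero : ∀ u, ¬ |u| ≤ R → g u = 0 := fun u hu => by
    by_contra h
    have := hR' (subset_tsupport g h)
    rw [Metric.mem_closedBall, dist_zero_right, Real.norm_eq_abs] at this
    exact hu (this.trans hRR)
  have hH : ∀ u v, ‖g u - g v‖ ≤ C * |u - v| ^ (α : ℝ) := fun u v => by
    have := hC.dist_le u v
    rwa [dist_eq_norm, Real.dist_eq] at this
  obtain ⟨c, hc0, hc⟩ := exists_regPart_le R hR0
  obtain ⟨D, hD⟩ : ∃ D, D = 2 * (C : ℝ) + 4 * B := ⟨_, rfl⟩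
  have hD0 : 0 ≤ D := by rw [hD]; positivity
  refine ⟨4 * (c * D), R, by positivity, fun u v => ?_⟩
  have hs : 0 ≤ (if |v - u| < 1 then |v - u| ^ ((α : ℝ) - 1) else 0) := by
    split_ifs <;> positivity
  have hi : 0 ≤ (Set.Icc (-R) R).indicator (fun _ => (1 : ℝ)) v :=
    Set.indicator_nonneg (fun _ _ => zero_le_one) _
  have hE := Real.exp_pos (-(1 / 2) * |v - u|)
  have hA : 0 ≤ 4 * (c * D) := by positivity
  rcases eq_or_ne u v with rfl | huv
  · rw [sub_self (g u), norm_zero, mul_zero]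
    positivity
  by_cases hout : ¬ |u| ≤ R ∧ ¬ |v| ≤ R
  · rw [hzero u hout.1, hzero v hout.2, sub_self, norm_zero, mul_zero]
    positivity
  have h1 := norm_sub_div_le C.coe_nonneg hB0 hH hB huv
  rw [← hD] at h1
  generalize (if |v - u| < 1 then |v - u| ^ ((α : ℝ) - 1) else 0) = S at *
  have e : nuDensity v * kernel 1 u v * ‖g u - g v‖ =
      4 * (regPart u v * (‖g u - g v‖ / (1 - Real.exp (-|u - v|)))) := by
    rw [nuDensity_mul_kernel]; ring
  rw [e, mul_assoc]
  refine mul_le_mul_of_nonneg_left ?_ (by norm_num)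
  refine (mul_le_mul_of_nonneg_left h1 (regPart_nonneg u v)).trans ?_
  by_cases hv : |v| ≤ R
  · rw [Set.indicator_of_mem (show v ∈ Set.Icc (-R) R from abs_le.1 hv)]
    calc _ ≤ c * (D * (S + 1)) := by gcongr; exact (hc u v).2 hv
      _ = c * D * (S + 1) := by ring
      _ ≤ _ := by gcongr; linarith
  · by_cases hu : |u| ≤ R
    · have h2 := (hc u v).1 hu
      rw [abs_sub_comm u v] at h2
      have h5 : Real.exp (-(1 / 2) * |v - u|) ≤ 1 :=
        Real.exp_le_one_iff.2 (by linarith [abs_nonneg (v - u)])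
      generalize Real.exp (-(1 / 2) * |v - u|) = E at *
      calc _ ≤ (c * E) * (D * (S + 1)) := by gcongr
        _ = c * D * (S * E + E) := by ring
        _ ≤ _ := mul_le_mul_of_nonneg_left (by nlinarith) (by positivity)
    · exact absurd ⟨hu, hv⟩ hout

lemma exists_lintegral_kernel_le {α : ℝ≥0} (hα : 0 < α) {g : ℝ → ℂ} (hg : IsHolderCc α g) :
    ∃ M : ℝ≥0, ∀ u, ∫⁻ v, ENNReal.ofReal (kernel 1 u v) * ‖g u - g v‖ₑ ∂nu ≤ M := by
  obtain ⟨A, R, hA, hpt⟩ := exists_pointwise_le hα hg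
  have hcont : Continuous g := hg.1.choose_spec.continuous hα
  obtain ⟨φ, hφd⟩ : ∃ φ : ℝ → ℝ, φ = fun r => 2 * (if |r| < 1 then |r| ^ ((α : ℝ) - 1) else 0) +
    Real.exp (-(1 / 2) * |r|) := ⟨_, rfl⟩
  obtain ⟨χ, hχd⟩ : ∃ χ : ℝ → ℝ, χ = (Set.Icc (-R) R).indicator fun _ => 1 := ⟨_, rfl⟩
  have hφ : Integrable φ := by
    rw [hφd]
    exact ((integrable_singular (a := α) (by exact_mod_cast hα)).const_mul 2).add
      (integrable_exp_neg_mul_abs (b := 1 / 2) (by norm_num))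
  have hχ : Integrable χ := by
    rw [hχd, integrable_indicator_iff measurableSet_Icc]
    exact integrableOn_const (by simp)
  have hpt' : ∀ u v, nuDensity v * kernel 1 u v * ‖g u - g v‖ ≤ A * (φ (v - u) + χ v) := by
    rw [hφd, hχd]; exact hpt
  refine ⟨(ENNReal.ofReal A * ((∫⁻ r, ENNReal.ofReal (φ r)) +
    ∫⁻ v, ENNReal.ofReal (χ v))).toNNReal, fun u => ?_⟩
  have hfin : ENNReal.ofReal A * ((∫⁻ r, ENNReal.ofReal (φ r)) +
      ∫⁻ v, ENNReal.ofReal (χ v)) ≠ ∞ :=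
    ENNReal.mul_ne_top ENNReal.ofReal_ne_top
      (ENNReal.add_ne_top.2 ⟨hφ.lintegral_lt_top.ne, hχ.lintegral_lt_top.ne⟩)
  rw [ENNReal.coe_toNNReal hfin]
  have hmk : Measurable fun v => kernel 1 u v := measurable_kernel_right 1 u
  have hmg : Measurable fun v => ‖g u - g v‖ₑ := by
    have := hcont.measurable; fun_prop
  have hm : Measurable fun v => ENNReal.ofReal (kernel 1 u v) * ‖g u - g v‖ₑ :=
    hmk.ennreal_ofReal.mul hmg
  unfold nu
  rw [lintegral_withDensity_eq_lintegral_mul _ measurable_nuDensity.ennreal_ofReal hm]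
  calc _ ≤ ∫⁻ v, ENNReal.ofReal A * (ENNReal.ofReal (φ (v - u)) + ENNReal.ofReal (χ v)) := by
        refine lintegral_mono fun v => ?_
        simp only [Pi.mul_apply]
        rw [← ofReal_norm, ← ENNReal.ofReal_mul (kernel_nonneg zero_le_one u v),
          ← ENNReal.ofReal_mul (nuDensity_nonneg v), ← mul_assoc]
        refine (ENNReal.ofReal_le_ofReal (hpt' u v)).trans ?_
        rw [ENNReal.ofReal_mul hA]
        gcongr
        exact ENNReal.ofReal_add_le
    _ = ENNReal.ofReal A * ((∫⁻ v, ENNReal.ofReal (φ (v - u))) + ∫⁻ v, ENNReal.ofReal (χ v)) := by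
        rw [lintegral_const_mul' _ _ ENNReal.ofReal_ne_top,
          lintegral_add_right' _ hχ.aemeasurable.ennreal_ofReal]
    _ = _ := by rw [lintegral_sub_right_eq_self (fun r => ENNReal.ofReal (φ r)) u]

/-- The complex Hilbert space `L²(ν)`. -/
abbrev H : Type := Lp ℂ 2 nu

/-- The classes in `L²(ν)` of the functions in `C_c^{0,α}`. -/
def coreDomain (α : ℝ≥0) : Submodule ℂ H where
  carrier := {ψ | ∃ g, IsHolderCc α g ∧ ψ =ᵐ[nu] g}
  add_mem' := by
    rintro ψ φ ⟨g, ⟨hg, hg'⟩, hψ⟩ ⟨f, ⟨hf, hf'⟩, hφ⟩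
    exact ⟨g + f, ⟨hg.add hf, hg'.add hf'⟩, (Lp.coeFn_add ψ φ).trans (hψ.add hφ)⟩
  zero_mem' := ⟨0, ⟨memHolder_zero, HasCompactSupport.zero⟩, Lp.coeFn_zero _ _ _⟩
  smul_mem' := by
    rintro c ψ ⟨g, ⟨hg, hg'⟩, hψ⟩
    exact ⟨c • g, ⟨hg.smul, hg'.smul_left (f := fun _ => c)⟩, (Lp.coeFn_smul c ψ).trans (hψ.const_smul c)⟩

/-- `(Lψ)(u) = ∫ ν(dv) k(u, v) (ψ(u) - ψ(v))`. -/
def diffIntegral (k : ℝ → ℝ → ℝ) (ψ : ℝ → ℂ) (u : ℝ) : ℂ :=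
  ∫ v, (k u v : ℂ) * (ψ u - ψ v) ∂nu

lemma diffIntegral_congr (k : ℝ → ℝ → ℝ) {ψ φ : ℝ → ℂ} (h : ψ =ᵐ[nu] φ) :
    diffIntegral k ψ =ᵐ[nu] diffIntegral k φ := by
  filter_upwards [h] with u hu
  refine integral_congr_ae ?_
  filter_upwards [h] with v hv
  rw [hu, hv]

section
variable {k : ℝ → ℝ → ℝ} {c : ℝ} {α : ℝ≥0} {g : ℝ → ℂ}

lemma exists_lintegral_le (hb : ∀ u v, |k u v| ≤ c * kernel 1 u v) (hα : 0 < α)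
    (hg : IsHolderCc α g) :
    ∃ M : ℝ≥0, ∀ u, ∫⁻ v, ‖(k u v : ℂ) * (g u - g v)‖ₑ ∂nu ≤ M := by
  obtain ⟨M, hM⟩ := exists_lintegral_kernel_le hα hg
  refine ⟨c.toNNReal * M, fun u => ?_⟩
  calc _ ≤ ∫⁻ v, ENNReal.ofReal c * (ENNReal.ofReal (kernel 1 u v) * ‖g u - g v‖ₑ) ∂nu := by
        refine lintegral_mono fun v => ?_
        rw [enorm_mul, ← mul_assoc, ← ENNReal.ofReal_mul' (kernel_nonneg zero_le_one u v)]
        gcongr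
        rw [← ofReal_norm, Complex.norm_real]
        exact ENNReal.ofReal_le_ofReal (hb u v)
    _ = ENNReal.ofReal c * ∫⁻ v, (ENNReal.ofReal (kernel 1 u v) * ‖g u - g v‖ₑ) ∂nu :=
        lintegral_const_mul' _ _ ENNReal.ofReal_ne_top
    _ ≤ ENNReal.ofReal c * M := by gcongr; exact hM u
    _ = _ := by simp [ENNReal.ofReal]

lemma integrable_diff (hk : Measurable (Function.uncurry k))
    (hb : ∀ u v, |k u v| ≤ c * kernel 1 u v) (hα : 0 < α) (hg : IsHolderCc α g) (u : ℝ) :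
    Integrable (fun v => (k u v : ℂ) * (g u - g v)) nu := by
  obtain ⟨M, hM⟩ := exists_lintegral_le hb hα hg
  have hcont : Continuous g := hg.1.choose_spec.continuous hα
  have hmk : Measurable fun v => k u v := hk.comp measurable_prodMk_left
  refine ⟨?_, (hM u).trans_lt ENNReal.coe_lt_top⟩
  have := hcont.measurable
  exact Measurable.aestronglyMeasurable (by fun_prop)

lemma memLp_diffIntegral (hk : Measurable (Function.uncurry k))
    (hb : ∀ u v, |k u v| ≤ c * kernel 1 u v) (hα : 0 < α) (hg : IsHolderCc α g) :
    MemLp (diffIntegral k g) 2 nu := by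
  obtain ⟨M, hM⟩ := exists_lintegral_le hb hα hg
  have hcont : Continuous g := hg.1.choose_spec.continuous hα
  have hm : StronglyMeasurable (diffIntegral k g) := by
    have := hcont.measurable
    have h : Measurable fun p : ℝ × ℝ => ((Function.uncurry k p : ℝ) : ℂ) * (g p.1 - g p.2) := by
      fun_prop
    exact h.stronglyMeasurable.integral_prod_right'
  refine MemLp.of_bound hm.aestronglyMeasurable M (ae_of_all _ fun u => ?_)
  have h := (enorm_integral_le_lintegral_enorm
    (fun v => (k u v : ℂ) * (g u - g v)) (μ := nu)).trans (hM u)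
  exact_mod_cast h

/-- The operator `ψ ↦ ∫ ν(dv) k(·, v) (ψ(·) - ψ(v))` in `L²(ν)` with domain `C_c^{0,α}`, for a
measurable kernel `k` that is dominated by the unregularized one. -/
def coreOp (k : ℝ → ℝ → ℝ) (hk : Measurable (Function.uncurry k))
    (hb : ∃ c, ∀ u v, |k u v| ≤ c * kernel 1 u v) (α : ℝ≥0) (hα : 0 < α) : H →ₗ.[ℂ] H :=
  have hmem : ∀ ψ : coreDomain α, MemLp (diffIntegral k ((ψ : H) : ℝ → ℂ)) 2 nu := fun ψ =>
    (memLp_diffIntegral hk hb.choose_spec hα ψ.2.choose_spec.1).ae_eq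
      (diffIntegral_congr k ψ.2.choose_spec.2).symm
  { domain := coreDomain α
    toFun :=
      { toFun := fun ψ => (hmem ψ).toLp _
        map_add' := by
          intro ψ φ
          obtain ⟨g, hg, hψ⟩ := ψ.2
          obtain ⟨f, hf, hφ⟩ := φ.2
          rw [← MemLp.toLp_add]
          refine MemLp.toLp_congr _ _ ?_
          refine (diffIntegral_congr k ((Lp.coeFn_add (ψ : H) φ).trans (hψ.add hφ))).trans ?_
          filter_upwards [diffIntegral_congr k hψ, diffIntegral_congr k hφ] with u h1 h2
          rw [Pi.add_apply, h1, h2]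
          unfold diffIntegral
          rw [← integral_add (integrable_diff hk hb.choose_spec hα hg u)
            (integrable_diff hk hb.choose_spec hα hf u)]
          congr 1; ext v; simp only [Pi.add_apply]; ring
        map_smul' := by
          intro a ψ
          rw [RingHom.id_apply, ← MemLp.toLp_const_smul]
          refine MemLp.toLp_congr _ _ ?_
          refine (diffIntegral_congr k (Lp.coeFn_smul a (ψ : H))).trans (ae_of_all _ fun u => ?_)
          simp only [diffIntegral, Pi.smul_apply, smul_eq_mul]
          rw [← integral_const_mul]
          congr 1; ext v; ring } }

end

/-- The unregularized operator `L₃` on `C_c^{0,α}`. -/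
def coreL (n : ℝ) (α : ℝ≥0) (hα : 0 < α) : H →ₗ.[ℂ] H :=
  coreOp (kernel n) (measurable_kernel n) ⟨|n|, fun u v => (abs_kernel n u v).le⟩ α hα

/-- The regularized operator `L₃^ε` on `C_c^{0,α}`. -/
def coreLReg (n ε₀ μ' γ₀ a₁ : ℝ) (α : ℝ≥0) (hα : 0 < α) : H →ₗ.[ℂ] H :=
  coreOp (kernelReg n ε₀ μ' γ₀ a₁) (measurable_kernelReg n ε₀ μ' γ₀ a₁)
    ⟨|n|, abs_kernelReg_le n ε₀ μ' γ₀ a₁⟩ α hα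

section Abstract

variable {E : Type*} [NormedAddCommGroup E] [InnerProductSpace ℂ E]

/-- The form domain of `T`: the limits `ψ` of sequences `φ n` in the domain of `T` that are Cauchy
for the quadratic form, i.e. `⟨φ m - φ n, T (φ m - φ n)⟩ → 0` as `m, n → ∞`. -/
def formDomain (T : E →ₗ.[ℂ] E) : Set E :=
  {ψ | ∃ φ : ℕ → T.domain, Tendsto (fun m => (φ m : E)) atTop (𝓝 ψ) ∧
    Tendsto (fun p : ℕ × ℕ => inner ℂ ((φ p.1 - φ p.2 : T.domain) : E) (T (φ p.1 - φ p.2)))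
      atTop (𝓝 0)}

/-- `A` is the Friedrichs extension of `T`: `T` is a densely defined, symmetric, non-negative
operator, and `A` is the restriction of the adjoint of `T` to the form domain of `T`. The last
clause determines `A`, since it prescribes the graph of `A`. -/
structure IsFriedrichsExtension (T A : E →ₗ.[ℂ] E) : Prop where
  dense_domain : Dense (T.domain : Set E)
  symmetric : T.IsFormalAdjoint T
  nonneg : ∀ φ : T.domain, 0 ≤ (inner ℂ (φ : E) (T φ)).re
  mem_graph_iff : ∀ ψ f : E, (ψ, f) ∈ A.graph ↔
    ψ ∈ formDomain T ∧ ∀ φ : T.domain, inner ℂ (T φ) ψ = inner ℂ (φ : E) f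

/-- The resolvent set of an unbounded operator: the `z` for which `z - A` is a bijection of the
domain of `A` onto `E` with bounded inverse `R`. -/
def resolventSet (A : E →ₗ.[ℂ] E) : Set ℂ :=
  {z | ∃ R : E →L[ℂ] E, (∀ f, ∃ ψ : A.domain, (ψ : E) = R f ∧ z • (ψ : E) - A ψ = f) ∧
    ∀ ψ : A.domain, R (z • (ψ : E) - A ψ) = ψ}

/-- The spectrum of an unbounded operator. -/
def spectrumOf (A : E →ₗ.[ℂ] E) : Set ℂ := (resolventSet A)ᶜ

/-- The spectrum, apart from the point `0`, is contained in a half-line `[δ, ∞)` with `δ > 0`. -/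
def HasSpectralGap (A : E →ₗ.[ℂ] E) : Prop :=
  ∃ δ : ℝ, 0 < δ ∧ ∀ z ∈ spectrumOf A, z = 0 ∨ ∃ x : ℝ, δ ≤ x ∧ z = x

/-- A strongly continuous semigroup of contractions. -/
structure IsContractionSemigroup (S : ℝ≥0 → E →L[ℂ] E) : Prop where
  map_zero : S 0 = ContinuousLinearMap.id ℂ E
  map_add : ∀ s t, S (s + t) = (S s).comp (S t)
  continuous : ∀ ψ, Continuous fun t => S t ψ
  norm_le : ∀ t, ‖S t‖ ≤ 1

/-- `-A` is the infinitesimal generator of `S`, so that `S t = e^{-tA}`. -/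
def IsGeneratedBy (S : ℝ≥0 → E →L[ℂ] E) (A : E →ₗ.[ℂ] E) : Prop :=
  ∀ ψ f : E, (ψ, f) ∈ A.graph ↔
    Tendsto (fun t : ℝ≥0 => ((t : ℝ)⁻¹ : ℂ) • (S t ψ - ψ)) (𝓝[>] 0) (𝓝 (-f))

end Abstract

end ThreeWave

end

/-! Multiplying the kernel by the densities of `ν` at `u` and `v` turns the fractional powers `5/2 -
3/2` into `1`: off the diagonal the joint weight is a multiple of `jumpDensity u v / (1 - exp (-|u -
v|))`, where `jumpDensity` is continuous, positive, symmetric and integrable on the plane. On the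
core the quadratic form is half the `energy`, the weighted double integral of `|ψ u - ψ v|²`. Each
of the two kernels `k` is symmetric and satisfies `c * K * (1 - exp (-|u - v|)) ≤ k ≤ C * K` with `K
= kernel 1` and `c > 0`; apart from measurability the argument uses nothing else
(`exists_friedrichsExtension_coreOp`).

The upper bound gives `tendsto_energy_tent`: wide tents tend to `1` in `L²(ν)` while their energies
tend to `0`, so the constants lie in the form domain and are annihilated. The lower bound reduces
the spectral gap to a Poincaré inequality for `jumpDensity` alone (`exists_poincare_jumpDensity`).
Near the origin `jumpDensity` is bounded below by compactness. Far out, all the mass `ν(dv)` is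
moved towards the origin by jumps whose density is at most a multiple of `jumpDensity`, and no point
`u` receives more than a quarter of its own density. Hence the outer `L²` norm squared is at most a
multiple of the energy plus half of the full norm squared, and that half is absorbed.

The functional analysis avoids working with the unbounded operator. Complete the core in the form
norm to a Hilbert space `V` with canonical map `j : V → E`; then `R = j j*` is the resolvent `(1 +
A)⁻¹` of the Friedrichs extension `A` (`exists_friedrichs_resolvent`). Everything about `A = R⁻¹ -
1` is read off the bounded self-adjoint `R`: self-adjointness from that of `R`, the semigroup from
the continuous functional calculus of `exp (-t (1 / x - 1))`, and the gap from the fact that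
Poincaré confines the spectrum of `R`, after the projection onto constants is subtracted, to `[0, 1
/ (1 + δ)]`. -/

noncomputable section

namespace ThreeWave

/-! ### Form completion and the resolvent of the Friedrichs extension. -/

section Abstract

universe u

variable {E : Type u} [NormedAddCommGroup E] [InnerProductSpace ℂ E]

/-- A type synonym of the domain of `T`, to carry the form norm. -/
def FormSpace (T : E →ₗ.[ℂ] E) : Type u := T.domain

instance (T : E →ₗ.[ℂ] E) : AddCommGroup (FormSpace T) := inferInstanceAs (AddCommGroup T.domain)

instance (T : E →ₗ.[ℂ] E) : Module ℂ (FormSpace T) := inferInstanceAs (Module ℂ T.domain)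

/-- The identification of the domain of `T` with its type synonym. -/
def toFormSpace (T : E →ₗ.[ℂ] E) : T.domain ≃ₗ[ℂ] FormSpace T := LinearEquiv.refl ℂ T.domain

/-- The form inner product `⟨φ, ψ⟩ + ⟨φ, T ψ⟩`. -/
abbrev formCore (T : E →ₗ.[ℂ] E) (hs : T.IsFormalAdjoint T)
    (hp : ∀ φ : T.domain, 0 ≤ (inner ℂ (φ : E) (T φ)).re) :
    InnerProductSpace.Core ℂ (FormSpace T) where
  inner φ ψ := inner ℂ (((toFormSpace T).symm φ : T.domain) : E) ((toFormSpace T).symm ψ : T.domain)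
    + inner ℂ (((toFormSpace T).symm φ : T.domain) : E) (T ((toFormSpace T).symm ψ))
  conj_inner_symm φ ψ := by
    rw [map_add, inner_conj_symm, inner_conj_symm, hs]
  re_inner_nonneg φ := by
    rw [map_add]
    exact add_nonneg inner_self_nonneg (hp _)
  add_left φ ψ χ := by
    simp only [map_add, Submodule.coe_add, inner_add_left]; ring
  smul_left φ ψ c := by
    simp only [map_smul, Submodule.coe_smul, inner_smul_left]; ring
  definite φ h := by
    have h1 := congrArg Complex.re h
    rw [Complex.add_re, Complex.zero_re] at h1
    have h2 := hp ((toFormSpace T).symm φ)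
    have h3 : 0 ≤ (inner ℂ (((toFormSpace T).symm φ : T.domain) : E)
      ((toFormSpace T).symm φ : T.domain)).re := inner_self_nonneg (𝕜 := ℂ)
    have h4 : (inner ℂ (((toFormSpace T).symm φ : T.domain) : E)
      ((toFormSpace T).symm φ : T.domain)).re = 0 := by linarith
    have h5 : (((toFormSpace T).symm φ : T.domain) : E) = 0 := by
      rw [← inner_self_eq_zero (𝕜 := ℂ)]
      exact Complex.ext h4 (inner_self_im (𝕜 := ℂ) _)
    have h6 : (toFormSpace T).symm φ = 0 := Subtype.ext h5
    exact (LinearEquiv.map_eq_zero_iff _).1 h6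

/-- The form domain is the image of a Hilbert space `V` in which the domain of `T` is dense. -/
lemma exists_formCompletion (T : E →ₗ.[ℂ] E) [CompleteSpace E] (hs : T.IsFormalAdjoint T)
    (hp : ∀ φ : T.domain, 0 ≤ (inner ℂ (φ : E) (T φ)).re) :
    ∃ (V : Type u) (_ : NormedAddCommGroup V) (_ : InnerProductSpace ℂ V) (_ : CompleteSpace V)
      (ι : T.domain →ₗ[ℂ] V) (j : V →L[ℂ] E), DenseRange ι ∧ (∀ φ, j (ι φ) = φ) ∧
      ∀ φ ψ, inner ℂ (ι φ) (ι ψ) = inner ℂ (φ : E) (ψ : E) + inner ℂ (φ : E) (T ψ) := by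
  let c := formCore T hs hp
  let : NormedAddCommGroup (FormSpace T) := c.toNormedAddCommGroup
  let : InnerProductSpace ℂ (FormSpace T) := InnerProductSpace.ofCore c.toCore
  have hin : ∀ φ ψ : FormSpace T, inner ℂ φ ψ =
    inner ℂ (((toFormSpace T).symm φ : T.domain) : E) ((toFormSpace T).symm ψ : T.domain)
    + inner ℂ (((toFormSpace T).symm φ : T.domain) : E) (T ((toFormSpace T).symm ψ)) :=
    fun _ _ => rfl
  let κ : FormSpace T →L[ℂ] UniformSpace.Completion (FormSpace T) :=
    UniformSpace.Completion.toComplL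
  let f : FormSpace T →ₗ[ℂ] E := T.domain.subtype.comp (toFormSpace T).symm.toLinearMap
  have hf : ∀ x, ‖f x‖ ≤ 1 * ‖x‖ := by
    intro x
    rw [one_mul]
    refine abs_le_of_sq_le_sq' ?_ (norm_nonneg _) |>.2
    rw [← inner_self_eq_norm_sq (𝕜 := ℂ), ← inner_self_eq_norm_sq (𝕜 := ℂ), hin, map_add]
    exact le_add_of_nonneg_right (hp _)
  let g : FormSpace T →L[ℂ] E := f.mkContinuous 1 hf
  have hd : DenseRange κ := UniformSpace.Completion.denseRange_coe
  have hu : IsUniformInducing κ := UniformSpace.Completion.isUniformInducing_coe _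
  refine ⟨UniformSpace.Completion (FormSpace T), inferInstance, inferInstance, inferInstance,
    κ.toLinearMap.comp (toFormSpace T).toLinearMap, g.extend κ, ?_, ?_, ?_⟩
  · exact hd.comp (toFormSpace T).surjective.denseRange κ.continuous
  · intro φ
    exact g.extend_eq hd hu (toFormSpace T φ)
  · intro φ ψ
    exact UniformSpace.Completion.inner_coe (𝕜 := ℂ) (toFormSpace T φ) (toFormSpace T ψ)

lemma tendsto_sub_prod_of_cauchySeq {G : Type*} [SeminormedAddCommGroup G] {x : ℕ → G} (hx : CauchySeq x) :
    Tendsto (fun p : ℕ × ℕ => x p.1 - x p.2) atTop (𝓝 0) := by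
  rw [cauchySeq_iff_tendsto_dist_atTop_0] at hx
  rw [tendsto_zero_iff_norm_tendsto_zero]
  simpa only [dist_eq_norm] using hx

/-- The resolvent `(1 + A)⁻¹` of the Friedrichs extension `A` of `T`. -/
lemma exists_friedrichs_resolvent [CompleteSpace E] (T : E →ₗ.[ℂ] E) (hs : T.IsFormalAdjoint T)
    (hp : ∀ φ : T.domain, 0 ≤ (inner ℂ (φ : E) (T φ)).re) :
    ∃ R : E →L[ℂ] E, IsSelfAdjoint R ∧
      (∀ ψ f, ψ = R (ψ + f) ↔
        ψ ∈ formDomain T ∧ ∀ φ : T.domain, inner ℂ (T φ) ψ = inner ℂ (φ : E) f) ∧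
      ∀ g, ∃ φ : ℕ → T.domain, Tendsto (fun m => (φ m : E)) atTop (𝓝 (R g)) ∧
        Tendsto (fun m => (inner ℂ (φ m : E) (T (φ m))).re) atTop
          (𝓝 (inner ℂ (R g) (g - R g)).re) := by
  obtain ⟨V, _, _, _, ι, j, hd, hj, hin⟩ := exists_formCompletion T hs hp
  -- By symmetry `T` can be put on the core vector, so the form identity extends by continuity to
  -- all of `V`. It shows that `w` is determined by `j w`, which is the closability of the form.
  have hin' : ∀ (φ : T.domain) (w : V),
      inner ℂ (ι φ) w = inner ℂ (φ : E) (j w) + inner ℂ (T φ) (j w) := by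
    intro φ w
    refine hd.induction_on (p := fun w : V =>
      inner ℂ (ι φ) w = inner ℂ (φ : E) (j w) + inner ℂ (T φ) (j w)) w ?_ ?_
    · exact isClosed_eq (by fun_prop) (by fun_prop)
    · intro ψ
      rw [hin, hj, hs]
  have hR : ∀ g, inner ℂ (j (j.adjoint g)) g = inner ℂ (j.adjoint g) (j.adjoint g) := fun g => by
    rw [← ContinuousLinearMap.adjoint_inner_right]
  have happrox : ∀ w : V, ∃ φ : ℕ → T.domain, Tendsto (fun m => ι (φ m)) atTop (𝓝 w) := by
    intro w
    obtain ⟨u, hu, hu'⟩ := mem_closure_iff_seq_limit.1 (hd.closure_eq ▸ Set.mem_univ w)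
    choose φ hφ using hu
    exact ⟨φ, by simpa only [hφ] using hu'⟩
  have hjt : ∀ {φ : ℕ → T.domain} {w : V}, Tendsto (fun m => ι (φ m)) atTop (𝓝 w) →
      Tendsto (fun m => (φ m : E)) atTop (𝓝 (j w)) := by
    intro φ w h
    simpa only [Function.comp_def, hj] using (j.continuous.tendsto w).comp h
  -- The vector `j* g` represents the functional `⟨j ·, g⟩` in the form inner product, so `j (j* g)`
  -- is the weak solution of `(1 + A) ψ = g`.
  refine ⟨j.comp j.adjoint, ?_, ?_, ?_⟩
  · rw [ContinuousLinearMap.isSelfAdjoint_iff']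
    rw [ContinuousLinearMap.adjoint_comp, ContinuousLinearMap.adjoint_adjoint]
  · intro ψ f
    simp only [ContinuousLinearMap.comp_apply]
    constructor
    · intro hψ
      obtain ⟨φ, hφ⟩ := happrox (j.adjoint (ψ + f))
      refine ⟨⟨φ, hψ ▸ hjt hφ, ?_⟩, fun χ => ?_⟩
      · have h1 := tendsto_sub_prod_of_cauchySeq hφ.cauchySeq
        have h2 := hjt hφ
        have h3 := tendsto_sub_prod_of_cauchySeq h2.cauchySeq
        have h4 := (h1.inner (𝕜 := ℂ) h1).sub (h3.inner (𝕜 := ℂ) h3)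
        simp only [inner_zero_left, sub_zero] at h4
        refine h4.congr fun p => ?_
        rw [← map_sub, hin, ← Submodule.coe_sub]
        ring
      · have h1 := hin' χ (j.adjoint (ψ + f))
        rw [ContinuousLinearMap.adjoint_inner_right, hj, ← hψ, inner_add_right] at h1
        exact (add_left_cancel h1).symm
    · rintro ⟨⟨φ, h1, h2⟩, h3⟩
      -- The squared form norm of a difference is its squared norm in `E` plus its energy, and both
      -- tend to `0`.
      have hc : CauchySeq fun m => ι (φ m) := by
        rw [cauchySeq_iff_tendsto_dist_atTop_0]
        have h4 := tendsto_sub_prod_of_cauchySeq h1.cauchySeq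
        have h5 := (h4.inner (𝕜 := ℂ) h4).add h2
        simp only [inner_zero_left, add_zero] at h5
        have h6 := (continuous_norm.tendsto _).comp h5
        simp only [norm_zero] at h6
        have h7 := (Real.continuous_sqrt.tendsto _).comp h6
        rw [Real.sqrt_zero] at h7
        refine h7.congr fun p => ?_
        simp only [Function.comp_def]
        rw [← Submodule.coe_sub, ← hin, map_sub, dist_eq_norm, inner_self_eq_norm_sq_to_K]
        simp
      obtain ⟨w, hw⟩ := cauchySeq_tendsto_of_complete hc
      have hjw : j w = ψ := tendsto_nhds_unique (hjt hw) h1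
      -- Tested against the dense core, both sides give `⟨χ, ψ + f⟩`.
      have : w = j.adjoint (ψ + f) := by
        refine hd.eq_of_inner_right ℂ fun χ => ?_
        rw [hin', ContinuousLinearMap.adjoint_inner_right, hj, hjw, inner_add_right, h3]
      rw [← this, hjw]
  · intro g
    -- The energy of `R g` is `‖j* g‖² - ‖R g‖²`, which is the limit of the energies of core
    -- vectors; this carries inequalities for `T` over to `R`.
    obtain ⟨φ, hφ⟩ := happrox (j.adjoint g)
    have h2 := hjt hφ
    refine ⟨φ, h2, ?_⟩
    have h4 := (hφ.inner (𝕜 := ℂ) hφ).sub (h2.inner (𝕜 := ℂ) h2)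
    have h5 := (Complex.continuous_re.tendsto _).comp h4
    have e : inner ℂ ((j.comp j.adjoint) g) (g - (j.comp j.adjoint) g) =
      inner ℂ (j.adjoint g) (j.adjoint g) - inner ℂ (j (j.adjoint g)) (j (j.adjoint g)) := by
      simp only [ContinuousLinearMap.comp_apply]
      rw [inner_sub_right, hR]
    rw [e]
    refine h5.congr fun m => ?_
    simp only [Function.comp_def]
    rw [hin]
    simp

end Abstract

/-! ### The unbounded operator `R⁻¹ - 1` of an injective self-adjoint `R`. -/

section Resolvent

variable {E : Type*} [NormedAddCommGroup E] [InnerProductSpace ℂ E]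

/-- The graph of `R⁻¹ - 1`. -/
def resolventGraph (R : E →L[ℂ] E) : Submodule ℂ (E × E) :=
  LinearMap.ker (LinearMap.fst ℂ E E - R.toLinearMap.comp (LinearMap.fst ℂ E E + LinearMap.snd ℂ E E))

lemma mem_resolventGraph {R : E →L[ℂ] E} {ψ f : E} :
    (ψ, f) ∈ resolventGraph R ↔ ψ = R (ψ + f) := by
  simp [resolventGraph, sub_eq_zero]

/-- The operator `R⁻¹ - 1` for an injective `R`. -/
def ofResolvent (R : E →L[ℂ] E) : E →ₗ.[ℂ] E := (resolventGraph R).toLinearPMap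

variable {R : E →L[ℂ] E}

/-- Injectivity makes the relation single-valued: a pair `(0, y)` in it forces `R y = 0`. -/
lemma mem_graph_ofResolvent (hinj : ∀ g, R g = 0 → g = 0) {ψ f : E} :
    (ψ, f) ∈ (ofResolvent R).graph ↔ ψ = R (ψ + f) := by
  rw [ofResolvent, Submodule.toLinearPMap_graph_eq, mem_resolventGraph]
  rintro ⟨x, y⟩ hx hx'
  rw [mem_resolventGraph] at hx
  simp only at hx'
  rw [hx', zero_add] at hx
  exact hinj y hx.symm

lemma apply_mem_graph_ofResolvent (hinj : ∀ g, R g = 0 → g = 0) (g : E) :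
    (R g, g - R g) ∈ (ofResolvent R).graph := by
  rw [mem_graph_ofResolvent hinj]; simp

lemma nonneg_ofResolvent (hinj : ∀ g, R g = 0 → g = 0)
    (hpos : ∀ g, 0 ≤ (inner ℂ (R g) (g - R g)).re) (ψ : (ofResolvent R).domain) :
    0 ≤ (inner ℂ (ψ : E) (ofResolvent R ψ)).re := by
  have h := (mem_graph_ofResolvent hinj).1 (LinearPMap.mem_graph (ofResolvent R) ψ)
  have := hpos (ψ + ofResolvent R ψ)
  rwa [← h, add_sub_cancel_left] at this

lemma norm_apply_sq_le_of_inner_nonneg (hpos : ∀ g, 0 ≤ (inner ℂ (R g) (g - R g)).re) (g : E) :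
    ‖R g‖ ^ 2 ≤ (inner ℂ (R g) g).re := by
  have h := hpos g
  rw [inner_sub_right, Complex.sub_re] at h
  have e : (inner ℂ (R g) (R g)).re = ‖R g‖ ^ 2 := inner_self_eq_norm_sq (𝕜 := ℂ) (R g)
  linarith

lemma norm_le_one_of_inner_nonneg (hpos : ∀ g, 0 ≤ (inner ℂ (R g) (g - R g)).re) : ‖R‖ ≤ 1 := by
  refine R.opNorm_le_bound zero_le_one fun g => ?_
  have h1 := norm_apply_sq_le_of_inner_nonneg hpos g
  have h2 : (inner ℂ (R g) g).re ≤ ‖R g‖ * ‖g‖ := re_inner_le_norm (𝕜 := ℂ) _ _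
  rw [one_mul]
  by_contra hc
  nlinarith [norm_nonneg g, norm_nonneg (R g)]

variable [CompleteSpace E]

lemma inner_apply_left_of_isSelfAdjoint (hR : IsSelfAdjoint R) (x y : E) :
    inner ℂ (R x) y = inner ℂ x (R y) := by
  have := ContinuousLinearMap.adjoint_inner_left R y x
  rwa [ContinuousLinearMap.isSelfAdjoint_iff'.1 hR] at this

/-- The orthogonal complement of the range of a self-adjoint operator is its kernel. -/
lemma denseRange_of_isSelfAdjoint (hR : IsSelfAdjoint R) (hinj : ∀ g, R g = 0 → g = 0) :
    DenseRange R := by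
  have h : (LinearMap.range R.toLinearMap).topologicalClosure = ⊤ := by
    rw [Submodule.topologicalClosure_eq_top_iff, Submodule.eq_bot_iff]
    intro x hx
    refine hinj x (ext_inner_left ℂ fun v => ?_)
    rw [inner_zero_right, ← inner_apply_left_of_isSelfAdjoint hR]
    exact (Submodule.mem_orthogonal _ _).1 hx _ ⟨v, rfl⟩
  have := (Submodule.dense_iff_topologicalClosure_eq_top).2 h
  exact this

/-- The right side tests `(ψ, f)` against the graph vectors `(R g, g - R g)`. Weak membership in the
graph is therefore membership; self-adjointness and the identification of the generator both rest on
this. -/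
lemma eq_apply_add_iff (hR : IsSelfAdjoint R) {ψ f : E} :
    ψ = R (ψ + f) ↔ ∀ g, inner ℂ (g - R g) ψ = inner ℂ (R g) f := by
  have key : ∀ g, inner ℂ (g - R g) ψ - inner ℂ (R g) f = inner ℂ g (ψ - R (ψ + f)) := fun g => by
    simp only [inner_sub_left, inner_sub_right, map_add, inner_add_right,
      inner_apply_left_of_isSelfAdjoint hR]
    ring
  constructor
  · intro h g
    rw [← sub_eq_zero, key, ← h, sub_self, inner_zero_right]
  · intro h
    rw [← sub_eq_zero]
    refine ext_inner_left ℂ fun g => ?_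
    rw [← key, h, sub_self, inner_zero_right]

lemma dense_domain_ofResolvent (hR : IsSelfAdjoint R) (hinj : ∀ g, R g = 0 → g = 0) :
    Dense ((ofResolvent R).domain : Set E) := by
  refine (denseRange_of_isSelfAdjoint hR hinj).mono ?_
  rintro _ ⟨g, rfl⟩
  exact LinearPMap.mem_domain_of_mem_graph (apply_mem_graph_ofResolvent hinj g)

lemma isSelfAdjoint_ofResolvent (hR : IsSelfAdjoint R) (hinj : ∀ g, R g = 0 → g = 0) :
    IsSelfAdjoint (ofResolvent R) := by
  rw [LinearPMap.isSelfAdjoint_def]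
  refine LinearPMap.eq_of_eq_graph ?_
  rw [LinearPMap.adjoint_graph_eq_graph_adjoint (dense_domain_ofResolvent hR hinj)]
  ext ⟨ψ, f⟩
  rw [mem_graph_ofResolvent hinj, eq_apply_add_iff hR, Submodule.mem_adjoint_iff]
  constructor
  · intro h g
    exact sub_eq_zero.1 (h _ _ (apply_mem_graph_ofResolvent hinj g))
  · intro h a b hab
    rw [mem_graph_ofResolvent hinj] at hab
    have := h (a + b)
    rw [← hab, add_sub_cancel_left] at this
    rw [this, sub_self]

lemma spectrum_real_subset_Icc (hR : IsSelfAdjoint R) (hpos : ∀ g, 0 ≤ (inner ℂ (R g) g).re)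
    {c : ℝ} (hc : ‖R‖ ≤ c) : spectrum ℝ R ⊆ Set.Icc 0 c := by
  intro x hx
  constructor
  · have h : 0 ≤ R := by
      rw [ContinuousLinearMap.nonneg_iff_isPositive, ContinuousLinearMap.isPositive_def']
      exact ⟨hR, hpos⟩
    exact spectrum_nonneg_of_nonneg h hx
  · have h1 := spectrum.subset_closedBall_norm_mul (𝕜 := ℝ) R hx
    rw [mem_closedBall_zero_iff] at h1
    -- Only an inequality, since `E` may be trivial.
    have h2 : ‖(1 : E →L[ℂ] E)‖ ≤ 1 := ContinuousLinearMap.norm_id_le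
    calc x ≤ ‖x‖ := le_abs_self x
      _ ≤ ‖R‖ * ‖(1 : E →L[ℂ] E)‖ := h1
      _ ≤ ‖R‖ * 1 := by gcongr
      _ ≤ c := by rwa [mul_one]

/-! ### The semigroup by functional calculus of the resolvent. -/

/-- The function `x ↦ exp (-t (1 / x - 1))`, extended by zero. -/
def expResolvent (t x : ℝ) : ℝ := Real.exp t * expNegInvGlue (x / t)

/-- Since `expNegInvGlue y` is `exp (-1 / y)` for `y > 0` and `0` otherwise, continuity also holds
at `0`. The functional calculus needs this because the spectrum of `R` may contain `0`. -/
lemma continuous_expResolvent (t : ℝ) : Continuous (expResolvent t) := by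
  have : Continuous expNegInvGlue := (expNegInvGlue.contDiff (n := 0)).continuous
  unfold expResolvent; fun_prop

lemma expResolvent_zero (t : ℝ) : expResolvent t 0 = 0 := by
  simp [expResolvent, expNegInvGlue]

lemma expResolvent_of_pos {t x : ℝ} (ht : 0 < t) (hx : 0 < x) :
    expResolvent t x = Real.exp (-(t * (1 / x - 1))) := by
  have h : 0 < x / t := by positivity
  rw [expResolvent, expNegInvGlue, if_neg (not_le.2 h), ← Real.exp_add]
  congr 1
  field_simp; ring

lemma expResolvent_add {s t : ℝ} (hs : 0 < s) (ht : 0 < t) {x : ℝ} (hx : 0 ≤ x) :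
    expResolvent (s + t) x = expResolvent s x * expResolvent t x := by
  rcases hx.eq_or_lt with rfl | hx
  · simp [expResolvent_zero]
  · rw [expResolvent_of_pos (add_pos hs ht) hx, expResolvent_of_pos hs hx,
      expResolvent_of_pos ht hx, ← Real.exp_add]
    congr 1; ring

lemma expResolvent_nonneg (t x : ℝ) : 0 ≤ expResolvent t x :=
  mul_nonneg (Real.exp_pos _).le (expNegInvGlue.nonneg _)

lemma exp_neg_le_quadratic {s : ℝ} (hs : 0 ≤ s) : Real.exp (-s) ≤ 1 - s + s ^ 2 := by
  have h1 : Real.exp (-s) ≤ 1 / (1 + s) := by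
    rw [Real.exp_neg, inv_eq_one_div]
    gcongr
    linarith [Real.add_one_le_exp s]
  refine h1.trans ?_
  rw [div_le_iff₀ (by positivity)]
  -- The product `(1 - s + s²) (1 + s)` equals `1 + s³`.
  nlinarith [pow_nonneg hs 3]

lemma expResolvent_le_one {t x : ℝ} (ht : 0 < t) (hx : x ∈ Set.Icc 0 1) :
    expResolvent t x ≤ 1 := by
  rcases hx.1.eq_or_lt with rfl | h
  · simp [expResolvent_zero]
  · rw [expResolvent_of_pos ht h, Real.exp_le_one_iff]
    have : 1 ≤ 1 / x := by rw [le_div_iff₀ h]; linarith [hx.2]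
    nlinarith

/-- With `y = 1 / x - 1`, the quotient `(1 - exp (-t y)) / t` is at most `y`, and `x y = 1 - x ≤ 1`.
-/
lemma abs_mul_expResolvent_sub_one_le {t x : ℝ} (ht : 0 < t) (hx : x ∈ Set.Icc 0 1) :
    |x * ((expResolvent t x - 1) / t)| ≤ 1 := by
  rcases hx.1.eq_or_lt with rfl | h
  · simp
  · have h1 := expResolvent_le_one ht hx
    rw [abs_mul, abs_div, abs_of_pos h, abs_of_pos ht, abs_sub_comm, abs_of_nonneg (by linarith),
      mul_div_assoc', div_le_one ht, expResolvent_of_pos ht h]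
    have h2 := Real.add_one_le_exp (-(t * (1 / x - 1)))
    have h3 : x * (t * (1 / x - 1)) = t * (1 - x) := by field_simp
    nlinarith

/-- The second-order error of the difference quotient is at most `t y²` with `y = 1 / x - 1`. The
second factor `x` makes it uniformly small: `x² y² = (1 - x)² ≤ 1`. -/
lemma abs_sq_mul_expResolvent_sub_one_le {t x : ℝ} (ht : 0 < t) (hx : x ∈ Set.Icc 0 1) :
    |x * ((expResolvent t x - 1) / t) * x + (1 - x) * x| ≤ t := by
  rcases hx.1.eq_or_lt with rfl | h
  · simp [ht.le]
  · rw [expResolvent_of_pos ht h]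
    have hy : 0 ≤ 1 / x - 1 := by
      rw [sub_nonneg, le_div_iff₀ h]; linarith [hx.2]
    have hxy : x * (1 / x - 1) = 1 - x := by field_simp
    obtain ⟨y, hyd⟩ : ∃ y, 1 / x - 1 = y := ⟨_, rfl⟩
    rw [hyd] at hy hxy ⊢
    have h2 := Real.add_one_le_exp (-(t * y))
    have h3 := exp_neg_le_quadratic (mul_nonneg ht.le hy)
    generalize Real.exp (-(t * y)) = z at *
    have e : x * ((z - 1) / t) * x + (1 - x) * x = x ^ 2 * ((z - 1 + t * y) / t) := by
      rw [← hxy]; field_simp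
    have h4 : 0 ≤ (z - 1 + t * y) / t := div_nonneg (by linarith) ht.le
    have h5 : (z - 1 + t * y) / t ≤ t * y ^ 2 := by
      rw [div_le_iff₀ ht]; nlinarith
    rw [e, abs_of_nonneg (by positivity)]
    calc x ^ 2 * ((z - 1 + t * y) / t) ≤ x ^ 2 * (t * y ^ 2) := by gcongr
      _ = t * (x * y) ^ 2 := by ring
      _ ≤ t * 1 := by
        gcongr
        rw [hxy]; nlinarith [hx.1, hx.2]
      _ = t := mul_one t

/-- The semigroup `exp (-t (R⁻¹ - 1))`. -/
def resolventSemigroup (R : E →L[ℂ] E) (t : ℝ≥0) : E →L[ℂ] E :=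
  open scoped Classical in
  -- At `t = 0` the division `x / t` gives `0`, so `expResolvent 0` vanishes identically and the
  -- identity has to be put in by hand.
  if t = 0 then ContinuousLinearMap.id ℂ E else cfc (expResolvent t) R

lemma resolventSemigroup_zero : resolventSemigroup R 0 = ContinuousLinearMap.id ℂ E := by
  simp [resolventSemigroup]

lemma resolventSemigroup_of_pos {t : ℝ≥0} (ht : 0 < t) :
    resolventSemigroup R t = cfc (expResolvent t) R := by
  simp [resolventSemigroup, ht.ne']

lemma isSelfAdjoint_resolventSemigroup (t : ℝ≥0) : IsSelfAdjoint (resolventSemigroup R t) := by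
  rcases eq_zero_or_pos t with rfl | ht
  · rw [resolventSemigroup_zero]; exact IsSelfAdjoint.one (E →L[ℂ] E)
  · rw [resolventSemigroup_of_pos ht]; exact cfc_predicate _ _

lemma norm_resolventSemigroup_le (hs : spectrum ℝ R ⊆ Set.Icc 0 1) (t : ℝ≥0) :
    ‖resolventSemigroup R t‖ ≤ 1 := by
  rcases eq_zero_or_pos t with rfl | ht
  · rw [resolventSemigroup_zero]; exact ContinuousLinearMap.norm_id_le
  · rw [resolventSemigroup_of_pos ht]
    refine norm_cfc_le zero_le_one fun x hx => ?_
    rw [Real.norm_of_nonneg (expResolvent_nonneg _ _)]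
    exact expResolvent_le_one (by exact_mod_cast ht) (hs hx)

lemma resolventSemigroup_add (hs : spectrum ℝ R ⊆ Set.Icc 0 1) (s t : ℝ≥0) :
    resolventSemigroup R (s + t) = (resolventSemigroup R s).comp (resolventSemigroup R t) := by
  rcases eq_zero_or_pos s with rfl | h1
  · rw [resolventSemigroup_zero, zero_add, ContinuousLinearMap.id_comp]
  rcases eq_zero_or_pos t with rfl | h2
  · rw [resolventSemigroup_zero, add_zero, ContinuousLinearMap.comp_id]
  rw [resolventSemigroup_of_pos h1, resolventSemigroup_of_pos h2,
    resolventSemigroup_of_pos (add_pos h1 h2), ← ContinuousLinearMap.mul_def,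
    ← cfc_mul _ _ R (continuous_expResolvent _).continuousOn (continuous_expResolvent _).continuousOn]
  refine cfc_congr fun x hx => ?_
  rw [NNReal.coe_add]
  exact expResolvent_add (by exact_mod_cast h1) (by exact_mod_cast h2) (hs hx).1

/-- The difference quotient of the semigroup, composed with the resolvent. -/
lemma exists_resolventQuotient (hR : IsSelfAdjoint R) (hs : spectrum ℝ R ⊆ Set.Icc 0 1)
    {t : ℝ≥0} (ht : 0 < t) : ∃ D : E →L[ℂ] E,
      (∀ g, ((t : ℝ)⁻¹ : ℂ) • (resolventSemigroup R t (R g) - R g) = D g) ∧ ‖D‖ ≤ 1 ∧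
      ‖D * R + (1 - R) * R‖ ≤ t := by
  have ht' : (0 : ℝ) < t := by exact_mod_cast ht
  have hc := continuous_expResolvent t
  refine ⟨cfc (fun x => x * ((expResolvent t x - 1) / t)) R, fun g => ?_, ?_, ?_⟩
  · have e : (fun x => x * ((expResolvent t x - 1) / t)) =
        fun x => (t : ℝ)⁻¹ • (expResolvent t x * x - x) := by
      ext x; simp only [smul_eq_mul]; ring
    rw [e, cfc_smul (t : ℝ)⁻¹ (fun x => expResolvent t x * x - x) R (by fun_prop),
      cfc_sub _ _ R (by fun_prop) (by fun_prop), cfc_mul _ _ R (by fun_prop) (by fun_prop),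
      cfc_id' ℝ R, resolventSemigroup_of_pos ht]
    rw [smul_apply, ← Complex.ofReal_inv, Complex.coe_smul]
    rfl
  · refine norm_cfc_le zero_le_one fun x hx => ?_
    exact abs_mul_expResolvent_sub_one_le ht' (hs hx)
  · have e : cfc (fun x => x * ((expResolvent t x - 1) / t) * x + (1 - x) * x) R =
        cfc (fun x => x * ((expResolvent t x - 1) / t)) R * R + (1 - R) * R := by
      rw [cfc_add R (fun x : ℝ => x * ((expResolvent t x - 1) / t) * x) (fun x => (1 - x) * x)
          (by fun_prop) (by fun_prop),
        cfc_mul (fun x : ℝ => x * ((expResolvent t x - 1) / t)) (fun x => x) R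
          (by fun_prop) (by fun_prop),
        cfc_mul (fun x : ℝ => 1 - x) (fun x => x) R (by fun_prop) (by fun_prop),
        cfc_sub (fun _ : ℝ => 1) (fun x => x) R (by fun_prop) (by fun_prop), cfc_id' ℝ R, cfc_const_one ℝ R]
    rw [← e]
    refine norm_cfc_le ht'.le fun x hx => ?_
    exact abs_sq_mul_expResolvent_sub_one_le ht' (hs hx)

lemma norm_resolventSemigroup_sub_le (hR : IsSelfAdjoint R) (hs : spectrum ℝ R ⊆ Set.Icc 0 1)
    (s t : ℝ≥0) (g : E) :
    ‖resolventSemigroup R (s + t) (R g) - resolventSemigroup R s (R g)‖ ≤ t * ‖g‖ := by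
  rw [resolventSemigroup_add hs, ContinuousLinearMap.comp_apply, ← map_sub]
  refine ((resolventSemigroup R s).le_of_opNorm_le (norm_resolventSemigroup_le hs s) _).trans ?_
  rw [one_mul]
  rcases eq_zero_or_pos t with rfl | ht
  · simp [resolventSemigroup_zero]
  · obtain ⟨D, h1, h2, -⟩ := exists_resolventQuotient hR hs ht
    have h3 := h1 g
    have ht' : (t : ℂ) ≠ 0 := by exact_mod_cast ht.ne'
    have h4 : resolventSemigroup R t (R g) - R g = (t : ℂ) • D g := by
      rw [← h3, smul_smul]
      simp [ht.ne']
    rw [h4, norm_smul]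
    have h5 : ‖(t : ℂ)‖ = t := by simp
    rw [h5]
    gcongr
    simpa using D.le_of_opNorm_le h2 g

lemma isContractionSemigroup_resolventSemigroup (hR : IsSelfAdjoint R)
    (hinj : ∀ g, R g = 0 → g = 0) (hs : spectrum ℝ R ⊆ Set.Icc 0 1) :
    IsContractionSemigroup (resolventSemigroup R) where
  map_zero := resolventSemigroup_zero
  map_add := resolventSemigroup_add hs
  norm_le := norm_resolventSemigroup_le hs
  continuous ψ := by
    have hrange : ∀ g, Continuous fun t => resolventSemigroup R t (R g) := by
      intro g
      have hle : ∀ s t : ℝ≥0, s ≤ t →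
          dist (resolventSemigroup R s (R g)) (resolventSemigroup R t (R g)) ≤ ‖g‖ * dist s t := by
        intro s t hst
        obtain ⟨r, rfl⟩ := exists_add_of_le hst
        have h := norm_resolventSemigroup_sub_le hR hs s r g
        rw [dist_comm, dist_eq_norm, NNReal.dist_eq]
        refine h.trans (le_of_eq ?_)
        push_cast
        rw [sub_add_cancel_left, abs_neg, NNReal.abs_eq]; ring
      refine (LipschitzWith.of_dist_le_mul (K := ‖g‖₊) fun s t => ?_).continuous
      rw [coe_nnnorm]
      rcases le_total s t with h | h
      · exact hle s t h
      · rw [dist_comm, dist_comm s]; exact hle t s h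
    -- Orbits of vectors in the range of `R` are Lipschitz in time. By contractivity they
    -- approximate every other orbit uniformly in `t`.
    refine continuous_of_uniform_approx_of_continuous fun u hu => ?_
    obtain ⟨ε, hε, hεu⟩ := Metric.mem_uniformity_dist.1 hu
    obtain ⟨g, hg⟩ := (denseRange_of_isSelfAdjoint hR hinj).exists_dist_lt ψ hε
    refine ⟨_, hrange g, fun t => hεu ?_⟩
    rw [dist_eq_norm, ← map_sub]
    refine ((resolventSemigroup R t).le_of_opNorm_le (norm_resolventSemigroup_le hs t) _).trans_lt ?_
    rwa [one_mul, ← dist_eq_norm]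

/-- The quotients composed with `R` are contractions, and on the range of `R` they converge at rate
`t`; density of the range gives convergence everywhere. -/
lemma tendsto_resolventQuotient (hR : IsSelfAdjoint R)
    (hinj : ∀ g, R g = 0 → g = 0) (hs : spectrum ℝ R ⊆ Set.Icc 0 1) (g : E) :
    Tendsto (fun t : ℝ≥0 => ((t : ℝ)⁻¹ : ℂ) • (resolventSemigroup R t (R g) - R g)) (𝓝[>] 0)
      (𝓝 (-(g - R g))) := by
  rw [Metric.tendsto_nhds]
  intro ε hε
  obtain ⟨h, hh⟩ := (denseRange_of_isSelfAdjoint hR hinj).exists_dist_lt g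
    -- Replacing `g` by `R h` costs at most `3 ‖g - R h‖ < ε / 2`: once through the quotient and
    -- twice through `1 - R`.
    (show 0 < ε / 6 by positivity)
  have hev : ∀ᶠ t : ℝ≥0 in 𝓝[>] 0, (t : ℝ) * ‖h‖ < ε / 2 := by
    have : Tendsto (fun t : ℝ≥0 => (t : ℝ) * ‖h‖) (𝓝[>] 0) (𝓝 (((0 : ℝ≥0) : ℝ) * ‖h‖)) :=
      Tendsto.mono_left (Continuous.tendsto (by fun_prop) 0) nhdsWithin_le_nhds
    rw [NNReal.coe_zero, zero_mul] at this
    exact this.eventually_lt_const (by positivity)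
  filter_upwards [hev, self_mem_nhdsWithin] with t h1 ht
  obtain ⟨D, hD, hD1, hD2⟩ := exists_resolventQuotient hR hs (Set.mem_Ioi.1 ht)
  have hR1 : ‖R‖ ≤ 1 := by
    rw [← cfc_id' ℝ R]
    refine norm_cfc_le zero_le_one fun x hx => ?_
    rw [Real.norm_of_nonneg (hs hx).1]; exact (hs hx).2
  rw [hD, dist_eq_norm]
  rw [dist_eq_norm] at hh
  have e : D g - -(g - R g) = D (g - R h) + ((g - R h) - R (g - R h)) +
      (D * R + (1 - R) * R) h := by
    have e' : (D * R + (1 - R) * R) h = D (R h) + (R h - R (R h)) := rfl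
    rw [e', map_sub, map_sub]
    abel
  rw [e]
  have n1 := D.le_of_opNorm_le hD1 (g - R h)
  have n2 := R.le_of_opNorm_le hR1 (g - R h)
  have n3 := (D * R + (1 - R) * R).le_of_opNorm_le hD2 h
  have n4 := norm_sub_le (g - R h) (R (g - R h))
  have n5 := norm_add₃_le (a := D (g - R h)) (b := (g - R h) - R (g - R h))
    (c := (D * R + (1 - R) * R) h)
  linarith

/-- Conversely, if the quotient converges at `ψ`, pair it with `R g`: the semigroup is self-adjoint,
so the quotient moves onto `R g`, where its limit is known. The result is the weak form of `(ψ, f)`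
lying in the graph. -/
lemma isGeneratedBy_resolventSemigroup (hR : IsSelfAdjoint R)
    (hinj : ∀ g, R g = 0 → g = 0) (hs : spectrum ℝ R ⊆ Set.Icc 0 1) :
    IsGeneratedBy (resolventSemigroup R) (ofResolvent R) := by
  intro ψ f
  rw [mem_graph_ofResolvent hinj]
  constructor
  · intro h
    have h1 := tendsto_resolventQuotient hR hinj hs (ψ + f)
    rwa [← h, add_sub_cancel_left] at h1
  · intro h
    rw [eq_apply_add_iff hR]
    intro g
    have h1 := (tendsto_resolventQuotient hR hinj hs g).inner (𝕜 := ℂ)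
      (tendsto_const_nhds (x := ψ))
    have h2 := (tendsto_const_nhds (x := R g) (f := 𝓝[>] (0 : ℝ≥0))).inner (𝕜 := ℂ) h
    have h3 : ∀ t : ℝ≥0, inner ℂ (((t : ℝ)⁻¹ : ℂ) • (resolventSemigroup R t (R g) - R g)) ψ =
        inner ℂ (R g) (((t : ℝ)⁻¹ : ℂ) • (resolventSemigroup R t ψ - ψ)) := by
      intro t
      rw [inner_smul_left, inner_smul_right, inner_sub_left, inner_sub_right,
        inner_apply_left_of_isSelfAdjoint (isSelfAdjoint_resolventSemigroup t)]
      simp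
    simp only [h3] at h1
    have h4 := tendsto_nhds_unique h1 h2
    rw [inner_neg_left, inner_neg_right] at h4
    exact neg_injective h4

end Resolvent

/-! ### From a Poincaré inequality to the spectral gap. -/

section Gap

variable {E : Type*} [NormedAddCommGroup E] [InnerProductSpace ℂ E] {R : E →L[ℂ] E} {e : E} {δ : ℝ}

/-- Here `-1 - A = -R⁻¹`. The substitution `w = (z + 1)⁻¹` used for the other points breaks down at
this one. -/
lemma mem_resolventSet_ofResolvent_neg_one (hinj : ∀ g, R g = 0 → g = 0) :
    -1 ∈ resolventSet (ofResolvent R) := by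
  refine ⟨-R, fun f => ?_, fun ψ => ?_⟩
  · obtain ⟨y, h1, h2⟩ := (LinearPMap.mem_graph_iff _).1 (apply_mem_graph_ofResolvent hinj (-f))
    refine ⟨y, ?_, ?_⟩
    · rw [h1]; simp
    · rw [h1, h2]; simp
  · have h := (mem_graph_ofResolvent hinj).1 (LinearPMap.mem_graph (ofResolvent R) ψ)
    conv_rhs => rw [h]
    rw [neg_apply, ← map_neg]
    congr 1
    rw [neg_one_smul]; abel

/-- With `w = (z + 1)⁻¹` one has `z - A = -w⁻¹ (w - R) R⁻¹`, whose inverse is `-w R (w - R)⁻¹`. -/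
lemma mem_resolventSet_ofResolvent (hinj : ∀ g, R g = 0 → g = 0) {z : ℂ} (hz : z + 1 ≠ 0)
    (hu : IsUnit (algebraMap ℂ (E →L[ℂ] E) (z + 1)⁻¹ - R)) :
    z ∈ resolventSet (ofResolvent R) := by
  obtain ⟨U, hU1, hU2⟩ := isUnit_iff_exists.1 hu
  have h1 : ∀ f, (z + 1)⁻¹ • U f - R (U f) = f := fun f => by
    have := congrArg (fun X : E →L[ℂ] E => X f) hU1
    simpa [Algebra.algebraMap_eq_smul_one] using this
  have h2 : ∀ f, U ((z + 1)⁻¹ • f - R f) = f := fun f => by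
    have := congrArg (fun X : E →L[ℂ] E => X f) hU2
    simpa [Algebra.algebraMap_eq_smul_one] using this
  have key : ∀ g, z • R g - (g - R g) = (z + 1) • (-((z + 1)⁻¹ • g - R g)) := fun g => by
    rw [smul_neg, smul_sub, smul_smul, mul_inv_cancel₀ hz, one_smul, add_smul, one_smul]; abel
  refine ⟨-((z + 1)⁻¹ • (R.comp U)), fun f => ?_, fun ψ => ?_⟩
  · obtain ⟨y, hy1, hy2⟩ := (LinearPMap.mem_graph_iff _).1
      (apply_mem_graph_ofResolvent hinj (-((z + 1)⁻¹ • U f)))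
    refine ⟨y, ?_, ?_⟩
    · rw [hy1]; simp
    · rw [hy1, hy2, key]
      have e : (z + 1)⁻¹ • -((z + 1)⁻¹ • U f) - R (-((z + 1)⁻¹ • U f)) = -((z + 1)⁻¹ • f) := by
        conv_rhs => rw [← h1 f]
        simp only [map_neg, map_smul, smul_neg, smul_sub]; abel
      rw [e, neg_neg, smul_smul, mul_inv_cancel₀ hz, one_smul]
  · have h := (mem_graph_ofResolvent hinj).1 (LinearPMap.mem_graph (ofResolvent R) ψ)
    have h3 := key (ψ + ofResolvent R ψ)
    rw [← h, add_sub_cancel_left] at h3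
    rw [h3]
    have h4 := h2 (ψ + ofResolvent R ψ)
    rw [← h] at h4
    rw [neg_apply, smul_apply, ContinuousLinearMap.comp_apply, map_smul, map_neg, h4]
    simp only [map_smul, map_neg, smul_neg, neg_neg, smul_smul, inv_mul_cancel₀ hz, one_smul]
    exact h.symm

/-- The orthogonal projection onto the line through a unit vector. -/
def lineProj (e : E) : E →L[ℂ] E := (innerSL ℂ e).smulRight e

lemma lineProj_apply (e x : E) : lineProj e x = inner ℂ e x • e := rfl

lemma norm_sub_lineProj_le (he : ‖e‖ = 1) (x : E) : ‖x - lineProj e x‖ ≤ ‖x‖ := by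
  have h : inner ℂ (x - lineProj e x) (lineProj e x) = 0 := by
    rw [lineProj_apply, inner_smul_right, inner_sub_left, inner_smul_left,
      inner_self_eq_norm_sq_to_K, he]
    simp
  have h2 := norm_add_sq_eq_norm_sq_add_norm_sq_of_inner_eq_zero _ _ h
  rw [sub_add_cancel] at h2
  nlinarith [norm_nonneg x, norm_nonneg (x - lineProj e x), mul_self_nonneg ‖lineProj e x‖]

lemma lineProj_mul_self (he : ‖e‖ = 1) : lineProj e * lineProj e = lineProj e := by
  ext x
  simp [lineProj_apply, inner_self_eq_norm_sq_to_K, he]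

lemma isUnit_sub_lineProj (he : ‖e‖ = 1) {w : ℂ} (hw0 : w ≠ 0) (hw1 : w ≠ 1) :
    IsUnit (algebraMap ℂ (E →L[ℂ] E) w - lineProj e) := by
  have hw : w - 1 ≠ 0 := sub_ne_zero.2 hw1
  have hp : ∀ x, lineProj e (lineProj e x) = lineProj e x := fun x =>
    congrArg (fun X : E →L[ℂ] E => X x) (lineProj_mul_self he)
  have key : ∀ x : E, w • (w⁻¹ • (x - lineProj e x) + (w - 1)⁻¹ • lineProj e x) -
      (w - 1)⁻¹ • lineProj e x = x := fun x => by
    have e1 : (w * (w - 1)⁻¹) • lineProj e x - (w - 1)⁻¹ • lineProj e x = lineProj e x := by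
      rw [← sub_smul, show w * (w - 1)⁻¹ - (w - 1)⁻¹ = 1 by field_simp, one_smul]
    rw [smul_add, smul_smul, smul_smul, mul_inv_cancel₀ hw0, one_smul, add_sub_assoc, e1,
      sub_add_cancel]
  refine isUnit_iff_exists.2 ⟨w⁻¹ • (1 - lineProj e) + (w - 1)⁻¹ • lineProj e, ?_, ?_⟩
  · ext x
    have := key x
    simpa [Algebra.algebraMap_eq_smul_one, hp] using this
  · ext x
    rw [Algebra.algebraMap_eq_smul_one]
    change w⁻¹ • ((w • x - lineProj e x) - lineProj e (w • x - lineProj e x)) +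
      (w - 1)⁻¹ • lineProj e (w • x - lineProj e x) = x
    simp only [map_sub, map_smul, hp]
    match_scalars <;> field_simp
    ring

variable [CompleteSpace E]

/-- The projection `P` commutes with `R`, and `R - P = R (1 - P)`. For `g` orthogonal to `e` the gap
inequality reads `(1 + δ) ‖R g‖² ≤ Re ⟨R g, g⟩`, so Cauchy–Schwarz bounds the norm by `1 / (1 + δ)`.
-/
lemma spectrum_sub_lineProj (hR : IsSelfAdjoint R) (hpos : ∀ g, 0 ≤ (inner ℂ (R g) (g - R g)).re)
    (he : ‖e‖ = 1) (hRe : R e = e) (hδ : 0 < δ)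
    (hgap : ∀ g, δ * ‖R g - lineProj e (R g)‖ ^ 2 ≤ (inner ℂ (R g) (g - R g)).re) :
    spectrum ℝ (R - lineProj e) ⊆ Set.Icc 0 (1 / (1 + δ)) ∧ IsSelfAdjoint (R - lineProj e) := by
  have hRP : ∀ x, R (lineProj e x) = lineProj e x := fun x => by
    rw [lineProj_apply, map_smul, hRe]
  have hPR : ∀ x, lineProj e (R x) = lineProj e x := fun x => by
    rw [lineProj_apply, lineProj_apply, ← inner_apply_left_of_isSelfAdjoint hR, hRe]
  have hPP : ∀ x, lineProj e (lineProj e x) = lineProj e x := fun x =>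
    congrArg (fun X : E →L[ℂ] E => X x) (lineProj_mul_self he)
  have hPs : ∀ x y, inner ℂ (lineProj e x) y = inner ℂ x (lineProj e y) := fun x y => by
    rw [lineProj_apply, lineProj_apply, inner_smul_left, inner_smul_right, inner_conj_symm, mul_comm]
  have hsa : IsSelfAdjoint (R - lineProj e) := by
    refine hR.sub ?_
    rw [ContinuousLinearMap.isSelfAdjoint_iff']
    refine (ContinuousLinearMap.eq_adjoint_iff _ _).2 hPs |>.symm
  have hsub : ∀ g, (R - lineProj e) g = R (g - lineProj e g) := fun g => by
    rw [sub_apply, map_sub, hRP]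
  have hP0 : ∀ g, lineProj e (R (g - lineProj e g)) = 0 := fun g => by
    rw [hPR, map_sub, hPP, sub_self]
  refine ⟨spectrum_real_subset_Icc hsa (fun g => ?_) ?_, hsa⟩
  · have h1 : inner ℂ ((R - lineProj e) g) g =
        inner ℂ (R (g - lineProj e g)) (g - lineProj e g) := by
      rw [hsub, inner_sub_right, ← hPs, hP0, inner_zero_left, sub_zero]
    rw [h1]
    exact (sq_nonneg _).trans (norm_apply_sq_le_of_inner_nonneg hpos _)
  · refine ContinuousLinearMap.opNorm_le_bound _ (by positivity) fun g => ?_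
    have h1 := hgap (g - lineProj e g)
    rw [hP0, sub_zero, inner_sub_right, Complex.sub_re, ← hsub] at h1
    have e1 : (inner ℂ ((R - lineProj e) g) ((R - lineProj e) g)).re =
      ‖(R - lineProj e) g‖ ^ 2 := inner_self_eq_norm_sq (𝕜 := ℂ) _
    have h2 : (inner ℂ ((R - lineProj e) g) (g - lineProj e g)).re ≤ _ :=
      re_inner_le_norm (𝕜 := ℂ) _ _
    have h3 := norm_sub_lineProj_le he g
    rw [e1] at h1
    have h4 := norm_nonneg ((R - lineProj e) g)
    generalize ‖(R - lineProj e) g‖ = a at *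
    rw [one_div, inv_mul_eq_div, le_div_iff₀ (by linarith)]
    rcases h4.eq_or_lt with rfl | h4
    · rw [zero_mul]; exact norm_nonneg g
    · have h5 : a * ‖g - lineProj e g‖ ≤ a * ‖g‖ := by gcongr
      have h6 : a * (a * (1 + δ)) ≤ a * ‖g‖ := by nlinarith
      exact le_of_mul_le_mul_left h6 h4

lemma hasSpectralGap_ofResolvent (hR : IsSelfAdjoint R) (hinj : ∀ g, R g = 0 → g = 0)
    (hpos : ∀ g, 0 ≤ (inner ℂ (R g) (g - R g)).re)
    (he : ‖e‖ = 1) (hRe : R e = e) (hδ : 0 < δ)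
    (hgap : ∀ g, δ * ‖R g - lineProj e (R g)‖ ^ 2 ≤ (inner ℂ (R g) (g - R g)).re) :
    HasSpectralGap (ofResolvent R) := by
  obtain ⟨hs, hsa⟩ := spectrum_sub_lineProj hR hpos he hRe hδ hgap
  refine ⟨δ, hδ, fun z hz => ?_⟩
  by_contra hcon
  push Not at hcon
  refine hz ?_
  by_cases hz1 : z + 1 = 0
  · rw [eq_neg_of_add_eq_zero_left hz1]
    exact mem_resolventSet_ofResolvent_neg_one hinj
  refine mem_resolventSet_ofResolvent hinj hz1 ?_
  obtain ⟨w, hw⟩ : ∃ w, w = (z + 1)⁻¹ := ⟨_, rfl⟩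
  rw [← hw]
  have hzw : z = w⁻¹ - 1 := by rw [hw, inv_inv]; ring
  have hw0 : w ≠ 0 := by rw [hw]; exact inv_ne_zero hz1
  have hw1 : w ≠ 1 := by
    rintro rfl
    exact hcon.1 (by rw [hzw]; norm_num)
  have hR' : IsUnit (algebraMap ℂ (E →L[ℂ] E) w - (R - lineProj e)) := by
    by_contra h
    have hmem : w ∈ spectrum ℂ (R - lineProj e) := h
    have hre := hsa.mem_spectrum_eq_re hmem
    have hx : w.re ∈ spectrum ℝ (R - lineProj e) := by
      rw [← spectrum.algebraMap_mem_iff ℂ]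
      rw [hre] at hmem
      exact hmem
    obtain ⟨h0, h1⟩ := hs hx
    have hpos' : 0 < w.re := by
      refine h0.lt_of_ne fun h => hw0 ?_
      rw [hre, ← h]; rfl
    -- A spectral value `w` in `(0, 1 / (1 + δ)]` corresponds to `z = 1 / w - 1 ≥ δ`, which is
    -- excluded.
    refine hcon.2 (w.re⁻¹ - 1) ?_ ?_
    · have : 1 + δ ≤ w.re⁻¹ := by
        rw [le_inv_comm₀ (by positivity) hpos', ← one_div]; exact h1
      linarith
    · rw [hzw, hre]; push_cast; simp
  -- Because `R P = P = P²`, the terms other than `w² - w R` cancel. Invertibility of `w - R` thus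
  -- splits into that on the complement of `e` and that on its line.
  have hprod : (algebraMap ℂ (E →L[ℂ] E) w - (R - lineProj e)) *
      (algebraMap ℂ (E →L[ℂ] E) w - lineProj e) = w • (algebraMap ℂ (E →L[ℂ] E) w - R) := by
    have h1 : R * lineProj e = lineProj e := by
      ext x
      simp [lineProj_apply, hRe]
    have h2 := lineProj_mul_self he
    simp only [Algebra.algebraMap_eq_smul_one, sub_mul, mul_sub, smul_mul_assoc, one_mul,
      mul_smul_comm, mul_one, h1, h2, smul_sub]
    abel
  have h := hR'.mul (isUnit_sub_lineProj he hw0 hw1)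
  rw [hprod] at h
  have h3 := h.smul (Units.mk0 w hw0)⁻¹
  rwa [Units.smul_def, smul_smul, Units.val_inv_eq_inv_val, Units.val_mk0, inv_mul_cancel₀ hw0,
    one_smul] at h3

/-- A densely defined, symmetric, non-negative operator that annihilates a unit vector of its form
domain in the weak sense and satisfies a Poincaré inequality has a self-adjoint, non-negative
Friedrichs extension with a spectral gap, which generates a contraction semigroup. -/
theorem exists_friedrichsExtension_of_poincare {T : E →ₗ.[ℂ] E} (hd : Dense (T.domain : Set E))
    (hs : T.IsFormalAdjoint T) (hp : ∀ φ : T.domain, 0 ≤ (inner ℂ (φ : E) (T φ)).re)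
    (he : ‖e‖ = 1) (heT : e ∈ formDomain T) (heT' : ∀ φ : T.domain, inner ℂ (T φ) e = 0)
    (hδ : 0 < δ)
    (hgap : ∀ φ : T.domain, δ * ‖(φ : E) - lineProj e φ‖ ^ 2 ≤ (inner ℂ (φ : E) (T φ)).re) :
    ∃ A : E →ₗ.[ℂ] E, IsFriedrichsExtension T A ∧ IsSelfAdjoint A ∧
      (∀ ψ : A.domain, 0 ≤ (inner ℂ (ψ : E) (A ψ)).re) ∧
      (∀ ψ : E, (ψ, (0 : E)) ∈ A.graph ↔ ∃ c : ℂ, ψ = c • e) ∧ HasSpectralGap A ∧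
      ∃ S : ℝ≥0 → E →L[ℂ] E, IsContractionSemigroup S ∧ IsGeneratedBy S A := by
  obtain ⟨R, hR, hiff, happ⟩ := exists_friedrichs_resolvent T hs hp
  -- If `R g = 0`, then `(0, g)` solves the weak equation, so `g` is orthogonal to the dense domain.
  have hinj : ∀ g, R g = 0 → g = 0 := fun g hg => by
    have h := ((hiff 0 g).1 (by rw [zero_add, hg])).2
    refine hd.eq_zero_of_inner_right (𝕜 := ℂ) fun v hv => ?_
    rw [← h ⟨v, hv⟩, inner_zero_right]
  have hgap' : ∀ g, δ * ‖R g - lineProj e (R g)‖ ^ 2 ≤ (inner ℂ (R g) (g - R g)).re := fun g => by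
    obtain ⟨φ, h1, h2⟩ := happ g
    refine le_of_tendsto_of_tendsto' ?_ h2 fun m => hgap (φ m)
    have hc : Continuous fun x : E => δ * ‖x - lineProj e x‖ ^ 2 := by fun_prop
    exact (hc.tendsto _).comp h1
  have hpos : ∀ g, 0 ≤ (inner ℂ (R g) (g - R g)).re := fun g =>
    le_trans (by positivity) (hgap' g)
  have hspec : spectrum ℝ R ⊆ Set.Icc 0 1 :=
    spectrum_real_subset_Icc hR (fun g => (sq_nonneg _).trans
      (norm_apply_sq_le_of_inner_nonneg hpos g)) (norm_le_one_of_inner_nonneg hpos)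
  have hRe : R e = e := by
    have := (hiff e 0).2 ⟨heT, fun φ => by rw [heT', inner_zero_right]⟩
    rw [add_zero] at this
    exact this.symm
  refine ⟨ofResolvent R, ⟨hd, hs, hp, fun ψ f => ?_⟩, isSelfAdjoint_ofResolvent hR hinj,
    nonneg_ofResolvent hinj hpos, fun ψ => ?_,
    hasSpectralGap_ofResolvent hR hinj hpos he hRe hδ hgap',
    resolventSemigroup R, isContractionSemigroup_resolventSemigroup hR hinj hspec,
    isGeneratedBy_resolventSemigroup hR hinj hspec⟩
  · rw [mem_graph_ofResolvent hinj, hiff]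
  · rw [mem_graph_ofResolvent hinj, add_zero]
    constructor
    · intro h
      have h1 := hgap' ψ
      rw [← h, sub_self, inner_zero_right, Complex.zero_re] at h1
      have h2 : ‖ψ - lineProj e ψ‖ ^ 2 ≤ 0 := by nlinarith
      have h3 : ‖ψ - lineProj e ψ‖ = 0 := by
        nlinarith [norm_nonneg (ψ - lineProj e ψ), sq_nonneg ‖ψ - lineProj e ψ‖]
      exact ⟨inner ℂ e ψ, sub_eq_zero.1 (norm_eq_zero.1 h3)⟩
    · rintro ⟨c, rfl⟩
      rw [map_smul, hRe]

end Gap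

/-! ### The joint jump density and its integrability. -/

section JumpDensity

/-- The joint density, up to a factor, of the jumps of the kernel without its line singularity. -/
def jumpDensity (u v : ℝ) : ℝ :=
  (softplus u * Real.exp (-u)) * (softplus v * Real.exp (-v)) *
    (Real.exp (-|u - v|) * (2 + Real.exp (max u v)) /
      (1 + Real.exp (-min u v) + Real.exp (-max u v)))

lemma jumpDensity_comm (u v : ℝ) : jumpDensity u v = jumpDensity v u := by
  unfold jumpDensity
  rw [abs_sub_comm, max_comm, min_comm]; ring

lemma jumpDensity_pos (u v : ℝ) : 0 < jumpDensity u v := by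
  have := softplus_pos u
  have := softplus_pos v
  unfold jumpDensity; positivity

lemma continuous_softplus : Continuous softplus := by
  unfold softplus
  exact Continuous.log (by fun_prop) fun x => by positivity

lemma continuous_jumpDensity : Continuous (Function.uncurry jumpDensity) := by
  have := continuous_softplus
  unfold Function.uncurry jumpDensity
  exact Continuous.mul (by fun_prop) (Continuous.div (by fun_prop) (by fun_prop)
    fun x => by positivity)

lemma nuDensity_mul_nuDensity_mul_kernel (u v : ℝ) :
    nuDensity u * nuDensity v * kernel 1 u v = 4 * jumpDensity u v / (1 - Real.exp (-|u - v|)) := by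
  have hu := softplus_pos u
  rw [mul_assoc, nuDensity_mul_kernel]
  have h : softplus u ^ (5 / 2 : ℝ) * softplus u ^ (-(3 / 2) : ℝ) = softplus u := by
    rw [← Real.rpow_add hu]; norm_num
  unfold regPart jumpDensity nuDensity
  calc _ = 4 * (softplus u ^ (5 / 2 : ℝ) * softplus u ^ (-(3 / 2) : ℝ) * Real.exp (-u) *
        (softplus v * Real.exp (-v)) * (Real.exp (-|u - v|) * (2 + Real.exp (max u v)) /
      (1 + Real.exp (-min u v) + Real.exp (-max u v)))) / (1 - Real.exp (-|u - v|)) := by ring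
    _ = _ := by rw [h]

lemma jumpDensity_eq_of_le {u v : ℝ} (h : u ≤ v) :
    jumpDensity u v = softplus u * softplus v * (Real.exp (-(2 * v)) * (2 + Real.exp v)) /
      (1 + Real.exp (-u) + Real.exp (-v)) := by
  unfold jumpDensity
  rw [max_eq_right h, min_eq_left h, abs_sub_comm, abs_of_nonneg (sub_nonneg.2 h)]
  have e : Real.exp (-(2 * v)) = Real.exp (-u) * Real.exp (-v) * Real.exp (-(v - u)) := by
    rw [← Real.exp_add, ← Real.exp_add]; congr 1; ring
  rw [e]; ring

/-- For a positive argument `softplus` is bounded by `4 exp (u / 4)`, for a negative one by `exp u`.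
When `u ≤ 0` the term `exp (-u)` of the denominator supplies the missing decay. The constant is `4 *
4 * 3`. -/
lemma jumpDensity_le_of_le {u v : ℝ} (h : u ≤ v) :
    jumpDensity u v ≤ 48 * (Real.exp (-(1 / 4) * |u|) * Real.exp (-(1 / 4) * |v|)) := by
  have hu := softplus_pos u
  have hv := softplus_pos v
  rw [jumpDensity_eq_of_le h, ← Real.exp_add]
  have hden : 1 ≤ 1 + Real.exp (-u) + Real.exp (-v) := by
    linarith [Real.exp_pos (-u), Real.exp_pos (-v)]
  have hden2 : Real.exp (-u) ≤ 1 + Real.exp (-u) + Real.exp (-v) := by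
    linarith [Real.exp_pos (-v)]
  rcases le_total 0 v with h0 | h0
  · have e1 : Real.exp (-(2 * v)) * (2 + Real.exp v) ≤ 3 * Real.exp (-v) := by
      have e2 : Real.exp (-(2 * v)) * Real.exp v = Real.exp (-v) := by
        rw [← Real.exp_add]; ring_nf
      have e3 : Real.exp (-(2 * v)) ≤ Real.exp (-v) := by gcongr; linarith
      linarith
    rcases le_total 0 u with h1 | h1
    · rw [abs_of_nonneg h0, abs_of_nonneg h1]
      calc _ ≤ softplus u * softplus v * (Real.exp (-(2 * v)) * (2 + Real.exp v)) :=
            div_le_self (by positivity) hden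
        _ ≤ (4 * Real.exp (u / 4)) * (4 * Real.exp (v / 4)) * (3 * Real.exp (-v)) := by
            gcongr
            · exact softplus_le_quarter u
            · exact softplus_le_quarter v
        _ = 48 * Real.exp (u / 4 + v / 4 + -v) := by rw [Real.exp_add, Real.exp_add]; ring
        _ ≤ _ := mul_le_mul_of_nonneg_left (Real.exp_le_exp.2 (by linarith)) (by norm_num)
    · rw [abs_of_nonneg h0, abs_of_nonpos h1]
      calc _ ≤ softplus u * softplus v * (Real.exp (-(2 * v)) * (2 + Real.exp v)) / Real.exp (-u) := by
            gcongr
        _ ≤ Real.exp u * (4 * Real.exp (v / 4)) * (3 * Real.exp (-v)) / Real.exp (-u) := by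
            gcongr
            · exact softplus_le u
            · exact softplus_le_quarter v
        _ = 12 * Real.exp (u + v / 4 + -v - -u) := by
            rw [Real.exp_sub, Real.exp_add, Real.exp_add]; ring
        _ ≤ 48 * Real.exp (u + v / 4 + -v - -u) := by gcongr; norm_num
        _ ≤ _ := by gcongr; linarith
  · rw [abs_of_nonpos h0, abs_of_nonpos (h.trans h0)]
    have e1 : 2 + Real.exp v ≤ 3 := by linarith [Real.exp_le_one_iff.2 h0]
    calc _ ≤ softplus u * softplus v * (Real.exp (-(2 * v)) * (2 + Real.exp v)) / Real.exp (-u) := by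
          gcongr
      _ ≤ Real.exp u * Real.exp v * (Real.exp (-(2 * v)) * 3) / Real.exp (-u) := by
          gcongr
          · exact softplus_le u
          · exact softplus_le v
      _ = 3 * Real.exp (u + v + -(2 * v) - -u) := by
          rw [Real.exp_sub, Real.exp_add, Real.exp_add]; ring
      _ ≤ 48 * Real.exp (u + v + -(2 * v) - -u) := by gcongr; norm_num
      _ ≤ _ := by gcongr; linarith

lemma jumpDensity_le (u v : ℝ) :
    jumpDensity u v ≤ 48 * (Real.exp (-(1 / 4) * |u|) * Real.exp (-(1 / 4) * |v|)) := by
  rcases le_total u v with h | h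
  · exact jumpDensity_le_of_le h
  · rw [jumpDensity_comm, mul_comm (Real.exp _)]
    exact jumpDensity_le_of_le h

lemma lintegral_jumpDensity_lt_top :
    ∫⁻ p : ℝ × ℝ, ENNReal.ofReal (jumpDensity p.1 p.2) < ∞ := by
  have h := integrable_exp_neg_mul_abs (b := 1 / 4) (by norm_num)
  have h2 := (h.mul_prod h).const_mul 48
  refine lt_of_le_of_lt (lintegral_mono fun p => ?_) h2.lintegral_lt_top
  exact ENNReal.ofReal_le_ofReal (jumpDensity_le p.1 p.2)

/-! ### Comparison of the weight with the jump density. -/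

lemma softplus_two_mul_le (u : ℝ) : softplus (2 * u) ≤ 2 * softplus u := by
  have h1 : 1 + Real.exp (2 * u) ≤ (1 + Real.exp u) ^ 2 := by
    have : Real.exp (2 * u) = Real.exp u ^ 2 := by rw [← Real.exp_nat_mul]; norm_num
    rw [this]; nlinarith [Real.exp_pos u]
  calc softplus (2 * u) ≤ Real.log ((1 + Real.exp u) ^ 2) := by unfold softplus; gcongr
    _ = 2 * softplus u := by rw [Real.log_pow]; simp [softplus]

lemma self_le_softplus (u : ℝ) : u ≤ softplus u := by
  unfold softplus
  rw [Real.le_log_iff_exp_le (by positivity)]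
  linarith

lemma softplus_le_add_one {u : ℝ} (hu : 0 ≤ u) : softplus u ≤ u + 1 := by
  unfold softplus
  rw [Real.log_le_iff_le_exp (by positivity), Real.exp_add]
  have h1 := Real.add_one_le_exp (1 : ℝ)
  have h2 := Real.one_le_exp hu
  nlinarith

lemma half_exp_le_softplus {u : ℝ} (hu : u ≤ 0) : Real.exp u / 2 ≤ softplus u := by
  refine le_trans ?_ (le_softplus u)
  gcongr
  linarith [Real.exp_le_one_iff.2 hu]

lemma two_rpow_le : (2 : ℝ) ^ (5 / 2 : ℝ) ≤ 6 := by
  refine abs_le_of_sq_le_sq' ?_ (by norm_num) |>.2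
  rw [← Real.rpow_natCast, ← Real.rpow_mul (by norm_num)]
  norm_num

lemma nuDensity_le_of_nonpos (u : ℝ) : nuDensity u ≤ Real.exp (3 / 2 * u) := by
  unfold nuDensity
  have h1 : softplus u ^ (5 / 2 : ℝ) ≤ (Real.exp u) ^ (5 / 2 : ℝ) :=
    Real.rpow_le_rpow (softplus_pos u).le (softplus_le u) (by norm_num)
  calc _ ≤ Real.exp (-u) * (Real.exp u) ^ (5 / 2 : ℝ) := by gcongr
    _ = _ := by rw [← Real.exp_mul, ← Real.exp_add]; ring_nf

lemma le_nuDensity_of_nonpos {u : ℝ} (hu : u ≤ 0) : Real.exp (3 / 2 * u) / 6 ≤ nuDensity u := by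
  unfold nuDensity
  have h1 : (Real.exp u / 2) ^ (5 / 2 : ℝ) ≤ softplus u ^ (5 / 2 : ℝ) :=
    Real.rpow_le_rpow (by positivity) (half_exp_le_softplus hu) (by norm_num)
  rw [Real.div_rpow (by positivity) (by norm_num), ← Real.exp_mul] at h1
  calc _ = Real.exp (-u) * (Real.exp (u * (5 / 2)) / 6) := by
        rw [mul_div_assoc', ← Real.exp_add]; ring_nf
    _ ≤ Real.exp (-u) * (Real.exp (u * (5 / 2)) / 2 ^ (5 / 2 : ℝ)) := by
        gcongr; exact two_rpow_le
    _ ≤ _ := by gcongr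

/-- At `+∞` the left side has order `v^(3/2) exp (-v)`, while the jump density has order `u v exp
(-v)`, hence `v² exp (-v)` on `[v / 2, v]`. -/
lemma two_div_mul_nuDensity_le {u v : ℝ} (hv : 48 < v) (h1 : v / 2 ≤ u) (h2 : u ≤ v) :
    2 / v * nuDensity v ≤ 24 * jumpDensity u v := by
  have hsu := softplus_pos u
  have hsv := softplus_pos v
  have hs1 : 1 ≤ softplus v := by linarith [self_le_softplus v]
  have hv0 : 0 < v := by linarith
  have a1 : softplus v / 2 ≤ softplus u := by
    have := softplus_two_mul_le (v / 2)
    rw [mul_div_cancel₀ v two_ne_zero] at this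
    linarith [softplus_mono h1]
  have a2 : 2 / v ≤ 4 / softplus v := by
    rw [div_le_div_iff₀ hv0 hsv]
    linarith [softplus_le_add_one hv0.le]
  have a3 : softplus v ^ (5 / 2 : ℝ) ≤ softplus v ^ 3 := by
    rw [← Real.rpow_natCast]
    exact Real.rpow_le_rpow_of_exponent_le hs1 (by norm_num)
  have a4 : 1 + Real.exp (-u) + Real.exp (-v) ≤ 3 := by
    linarith [Real.exp_le_one_iff.2 (show -u ≤ 0 by linarith),
      Real.exp_le_one_iff.2 (show -v ≤ 0 by linarith)]
  have a5 : Real.exp (-v) ≤ Real.exp (-(2 * v)) * (2 + Real.exp v) := by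
    have : Real.exp (-(2 * v)) * Real.exp v = Real.exp (-v) := by rw [← Real.exp_add]; ring_nf
    nlinarith [Real.exp_pos (-(2 * v))]
  rw [jumpDensity_eq_of_le h2]
  calc 2 / v * nuDensity v ≤ 4 / softplus v * (Real.exp (-v) * softplus v ^ 3) := by
        unfold nuDensity
        have : 0 ≤ softplus v ^ (5 / 2 : ℝ) := by positivity
        gcongr
    _ = 24 * (softplus v / 2 * softplus v * Real.exp (-v) / 3) := by field_simp; norm_num
    _ ≤ _ := by gcongr

/-- At `-∞` the weight has order `exp (3 u / 2)`. The jump density has order `exp (2 u - v)`, which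
is at least `exp (u - 16)` for jumps of length at most `16`. -/
lemma nuDensity_div_le {u v : ℝ} (hu : u < -16) (h1 : u ≤ v) (h2 : v ≤ u + 16) :
    nuDensity u / 16 ≤ Real.exp 16 * jumpDensity u v := by
  have hsu := softplus_pos u
  have hsv := softplus_pos v
  have a1 := half_exp_le_softplus (show u ≤ 0 by linarith)
  have a2 := half_exp_le_softplus (show v ≤ 0 by linarith)
  have a3 : 1 + Real.exp (-u) + Real.exp (-v) ≤ 3 * Real.exp (-u) := by
    have b1 : 1 ≤ Real.exp (-u) := Real.one_le_exp (by linarith)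
    have b2 : Real.exp (-v) ≤ Real.exp (-u) := by gcongr
    linarith
  rw [jumpDensity_eq_of_le h1]
  calc nuDensity u / 16 ≤ Real.exp (3 / 2 * u) / 16 := by gcongr; exact nuDensity_le_of_nonpos u
    _ ≤ Real.exp u / 16 := by gcongr; linarith
    _ ≤ Real.exp u / 6 := by gcongr; norm_num
    _ ≤ Real.exp (16 + (u + v + -(2 * v) - -u)) / 6 := by gcongr; linarith
    _ = Real.exp 16 * (Real.exp u / 2 * (Real.exp v / 2) * (Real.exp (-(2 * v)) * 2) /
          (3 * Real.exp (-u))) := by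
        rw [Real.exp_add, Real.exp_sub, Real.exp_add, Real.exp_add]; field_simp; norm_num
    _ ≤ _ := by
        gcongr
        linarith [Real.exp_pos v]

lemma exists_nuDensity_le_of_mem_Icc (a b : ℝ) : ∃ c, 0 ≤ c ∧ ∀ u ∈ Set.Icc a b, ∀ v ∈ Set.Icc a b,
    nuDensity u ≤ c * jumpDensity u v := by
  rcases (Set.Icc a b).eq_empty_or_nonempty with h | h
  · exact ⟨0, le_rfl, fun u hu => by simp [h] at hu⟩
  obtain ⟨⟨x, y⟩, -, hxy⟩ := ((isCompact_Icc (a := a) (b := b)).prod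
    (isCompact_Icc (a := a) (b := b))).exists_isMinOn (h.prod h) continuous_jumpDensity.continuousOn
  have hp := jumpDensity_pos x y
  refine ⟨32 / jumpDensity x y, by positivity, fun u hu v hv => ?_⟩
  have h1 : jumpDensity x y ≤ jumpDensity u v := hxy (Set.mk_mem_prod hu hv)
  have h2 : nuDensity u ≤ 32 := (nuDensity_le u).trans <| by
    linarith [Real.exp_le_one_iff.2 (show -(3 / 8) * |u| ≤ 0 by linarith [abs_nonneg u])]
  refine h2.trans ?_
  rw [div_mul_eq_mul_div, le_div_iff₀ hp]
  gcongr

/-! ### Inward transport of the outer mass. -/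

/-- The density of the jumps from `v` towards the origin that are used to bound a function near
infinity by its values near the origin. -/
def inwardDensity (v u : ℝ) : ℝ :=
  open scoped Classical in
  if 48 < v ∧ v / 2 ≤ u ∧ u ≤ v then 2 / v * nuDensity v
  else if v < -16 ∧ v ≤ u ∧ u ≤ v + 16 then nuDensity v / 16 else 0

lemma measurable_inwardDensity : Measurable (Function.uncurry inwardDensity) := by
  have := measurable_nuDensity
  unfold Function.uncurry inwardDensity
  refine Measurable.ite ?_ (by fun_prop) (Measurable.ite ?_ (by fun_prop) (by fun_prop))
  · exact (measurableSet_lt measurable_const measurable_fst).inter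
      ((measurableSet_le (measurable_fst.div_const 2) measurable_snd).inter
        (measurableSet_le measurable_snd measurable_fst))
  · exact (measurableSet_lt measurable_fst measurable_const).inter
      ((measurableSet_le measurable_fst measurable_snd).inter
        (measurableSet_le measurable_snd (measurable_fst.add_const 16)))

lemma inwardDensity_le (v u : ℝ) :
    inwardDensity v u ≤ (24 + Real.exp 16) * jumpDensity v u := by
  have hp := jumpDensity_pos v u
  unfold inwardDensity
  split_ifs with h1 h2
  · rw [jumpDensity_comm] at *
    refine (two_div_mul_nuDensity_le h1.1 h1.2.1 h1.2.2).trans ?_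
    gcongr
    linarith [Real.exp_pos 16]
  · refine (nuDensity_div_le h2.1 h2.2.1 h2.2.2).trans ?_
    gcongr
    linarith
  · positivity

/-- The target intervals have lengths `v / 2` and `16`, which explains the normalizations `2 / v`
and `1 / 16`: the whole mass at an outer point is moved. -/
lemma lintegral_inwardDensity {v : ℝ} (hv : v ∉ Set.Icc (-16) 48) :
    ∫⁻ u, ENNReal.ofReal (inwardDensity v u) = ENNReal.ofReal (nuDensity v) := by
  rcases lt_or_ge 48 v with h | h
  · have e : (fun u => ENNReal.ofReal (inwardDensity v u)) =
        (Set.Icc (v / 2) v).indicator fun _ => ENNReal.ofReal (2 / v * nuDensity v) := by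
      ext u
      have hn : ¬ v < -16 := by linarith
      by_cases hu : u ∈ Set.Icc (v / 2) v
      · rw [Set.indicator_of_mem hu, inwardDensity, if_pos ⟨h, hu⟩]
      · rw [Set.indicator_of_notMem hu, inwardDensity, if_neg fun h => hu h.2,
          if_neg fun h => hn h.1, ENNReal.ofReal_zero]
    have := nuDensity_nonneg v
    rw [e, lintegral_indicator measurableSet_Icc, setLIntegral_const, Real.volume_Icc,
      ← ENNReal.ofReal_mul (by positivity)]
    congr 1
    field_simp; ring
  · have h' : v < -16 := by
      by_contra hc
      exact hv ⟨not_lt.1 hc, h⟩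
    have e : (fun u => ENNReal.ofReal (inwardDensity v u)) =
        (Set.Icc v (v + 16)).indicator fun _ => ENNReal.ofReal (nuDensity v / 16) := by
      ext u
      by_cases hu : u ∈ Set.Icc v (v + 16)
      · rw [Set.indicator_of_mem hu, inwardDensity, if_neg fun h1 => h1.1.not_ge h, if_pos ⟨h', hu⟩]
      · rw [Set.indicator_of_notMem hu, inwardDensity, if_neg fun h1 => h1.1.not_ge h,
          if_neg fun h1 => hu h1.2, ENNReal.ofReal_zero]
    have := nuDensity_nonneg v
    rw [e, lintegral_indicator measurableSet_Icc, setLIntegral_const, Real.volume_Icc,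
      ← ENNReal.ofReal_mul (by positivity)]
    congr 1
    ring

/-- Only sources `v ∈ [u, 2 u]` with `v > 48` reach `u`. There `2 / v ≤ 1 / 24` and `softplus v ^
(5/2) ≤ 6 softplus u ^ (5/2)`, and `6 / 24 = 1 / 4`. The null case `v = u` is split off so that the
indicator of an open half-line suffices. -/
lemma inwardDensity_le_of_nonneg {u : ℝ} (hu : 0 ≤ u) (v : ℝ) :
    inwardDensity v u ≤ (Set.Ioi u).indicator (fun v => Real.exp (-v)) v *
      (softplus u ^ (5 / 2 : ℝ) / 4) ∨ v = u := by
  have hsu := softplus_pos u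
  have hsv := softplus_pos v
  by_cases hvu : v = u
  · exact Or.inr hvu
  left
  unfold inwardDensity
  split_ifs with h1 h2
  · have hmem : v ∈ Set.Ioi u := lt_of_le_of_ne h1.2.2 (Ne.symm hvu)
    rw [Set.indicator_of_mem hmem]
    have a1 : softplus v ≤ 2 * softplus u :=
      (softplus_mono (by linarith)).trans (softplus_two_mul_le u)
    have a2 : softplus v ^ (5 / 2 : ℝ) ≤ 6 * softplus u ^ (5 / 2 : ℝ) := by
      refine (Real.rpow_le_rpow hsv.le a1 (by norm_num)).trans ?_
      rw [Real.mul_rpow (by norm_num) hsu.le]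
      gcongr
      exact two_rpow_le
    have a3 : 2 / v ≤ 1 / 24 := by
      rw [div_le_div_iff₀ (by linarith) (by norm_num)]; linarith
    unfold nuDensity
    calc _ ≤ 1 / 24 * (Real.exp (-v) * (6 * softplus u ^ (5 / 2 : ℝ))) := by gcongr
      _ = _ := by ring
  · linarith [h2.1, h2.2.2]
  · exact mul_nonneg (Set.indicator_nonneg (fun x _ => (Real.exp_pos _).le) _) (by positivity)

lemma inwardDensity_le_of_neg {u : ℝ} (hu : u < 0) (v : ℝ) :
    inwardDensity v u ≤ (Set.Iic u).indicator (fun v => Real.exp (3 / 2 * v)) v * (1 / 16) := by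
  unfold inwardDensity
  split_ifs with h1 h2
  · linarith [h1.1, h1.2.1]
  · rw [Set.indicator_of_mem (show v ∈ Set.Iic u from h2.2.1)]
    have := nuDensity_le_of_nonpos v
    linarith
  · exact mul_nonneg (Set.indicator_nonneg (fun x _ => (Real.exp_pos _).le) _) (by norm_num)

/-- The factor `1 / 4` makes the absorption in the Poincaré inequality possible, and the thresholds
`48` and `16` are large enough for it. For `u < 0` the incoming mass is at most `exp (3 u / 2) /
24`, and the weight is at least `exp (3 u / 2) / 6`. -/
lemma lintegral_inwardDensity_left_le (u : ℝ) :
    ∫⁻ v, ENNReal.ofReal (inwardDensity v u) ≤ ENNReal.ofReal (nuDensity u / 4) := by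
  rcases le_or_gt 0 u with hu | hu
  · have hi : Integrable ((Set.Ioi u).indicator fun v => Real.exp (-v)) :=
      (integrable_indicator_iff measurableSet_Ioi).2 (integrableOn_exp_neg_Ioi u)
    calc _ ≤ ∫⁻ v, ENNReal.ofReal ((Set.Ioi u).indicator (fun v => Real.exp (-v)) v *
            (softplus u ^ (5 / 2 : ℝ) / 4)) := by
          refine lintegral_mono_ae ?_
          have hne : ∀ᵐ v : ℝ, v ≠ u := by
            rw [ae_iff]; simp
          filter_upwards [hne] with v hv
          exact ENNReal.ofReal_le_ofReal ((inwardDensity_le_of_nonneg hu v).resolve_right hv)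
      _ = ENNReal.ofReal (∫ v, (Set.Ioi u).indicator (fun v => Real.exp (-v)) v *
            (softplus u ^ (5 / 2 : ℝ) / 4)) := by
          have := softplus_pos u
          refine (ofReal_integral_eq_lintegral_ofReal (hi.mul_const _) (ae_of_all _ fun v => ?_)).symm
          exact mul_nonneg (Set.indicator_nonneg (fun x _ => (Real.exp_pos _).le) _) (by positivity)
      _ = _ := by
          rw [integral_mul_const, integral_indicator measurableSet_Ioi, integral_exp_neg_Ioi]
          unfold nuDensity; ring_nf
  · have hi0 : IntegrableOn (fun v => Real.exp (3 / 2 * v)) (Set.Iic u) :=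
      integrableOn_exp_mul_Iic (by norm_num) u
    have hi : Integrable ((Set.Iic u).indicator fun v => Real.exp (3 / 2 * v)) :=
      (integrable_indicator_iff measurableSet_Iic).2 hi0
    calc _ ≤ ∫⁻ v, ENNReal.ofReal ((Set.Iic u).indicator (fun v => Real.exp (3 / 2 * v)) v *
            (1 / 16)) :=
          lintegral_mono fun v => ENNReal.ofReal_le_ofReal (inwardDensity_le_of_neg hu v)
      _ = ENNReal.ofReal (∫ v, (Set.Iic u).indicator (fun v => Real.exp (3 / 2 * v)) v *
            (1 / 16)) := by
          refine (ofReal_integral_eq_lintegral_ofReal (hi.mul_const _) (ae_of_all _ fun v => ?_)).symm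
          exact mul_nonneg (Set.indicator_nonneg (fun x _ => (Real.exp_pos _).le) _) (by norm_num)
      _ ≤ _ := by
          rw [integral_mul_const, integral_indicator measurableSet_Iic,
            integral_exp_mul_Iic (by norm_num)]
          refine ENNReal.ofReal_le_ofReal ?_
          linarith [le_nuDensity_of_nonpos hu.le]

end JumpDensity

/-! ### The Poincaré inequality for the jump density. -/

section Poincare

lemma enorm_sq_le_add {G : Type*} [SeminormedAddCommGroup G] (a b : G) :
    ‖a‖ₑ ^ 2 ≤ 2 * ‖a - b‖ₑ ^ 2 + 2 * ‖b‖ₑ ^ 2 := by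
  simp only [enorm_eq_nnnorm]
  norm_cast
  have h : ‖a‖₊ ≤ ‖a - b‖₊ + ‖b‖₊ := by
    simpa using nnnorm_add_le (a - b) b
  calc ‖a‖₊ ^ 2 ≤ (‖a - b‖₊ + ‖b‖₊) ^ 2 := by gcongr
    _ ≤ 2 * (‖a - b‖₊ ^ 2 + ‖b‖₊ ^ 2) := add_sq_le
    _ = _ := by ring

lemma measurable_jumpDensity : Measurable (Function.uncurry jumpDensity) :=
  continuous_jumpDensity.measurable

lemma lintegral_nuDensity_lt_top : ∫⁻ v, ENNReal.ofReal (nuDensity v) < ∞ := by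
  have := measure_lt_top nu Set.univ
  rwa [nu, withDensity_apply _ MeasurableSet.univ, Measure.restrict_univ] at this

/-- Average over the reference point in `[0, 1]`: some `w` does no worse than the mean, and the mean
is controlled by the energy because the jump density is bounded below on the compact square. -/
lemma exists_mem_Icc_lintegral_le : ∃ C : ℝ≥0, ∀ f : ℝ → ℂ, Measurable f → ∃ w : ℝ,
    ∫⁻ v in Set.Icc (-16) 48, ENNReal.ofReal (nuDensity v) * ‖f v - f w‖ₑ ^ 2 ≤
      C * ∫⁻ v, ∫⁻ u, ENNReal.ofReal (jumpDensity v u) * ‖f v - f u‖ₑ ^ 2 := by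
  obtain ⟨c, hc0, hc⟩ := exists_nuDensity_le_of_mem_Icc (-16) 48
  refine ⟨c.toNNReal, fun f hf => ?_⟩
  have hprob : IsProbabilityMeasure (volume.restrict (Set.Icc (0 : ℝ) 1)) :=
    ⟨by simp⟩
  have hρ := measurable_nuDensity
  have hJ := measurable_jumpDensity
  have hm : Measurable fun p : ℝ × ℝ =>
      ENNReal.ofReal (nuDensity p.2) * ‖f p.2 - f p.1‖ₑ ^ 2 := by fun_prop
  have hF : Measurable fun w => ∫⁻ v in Set.Icc (-16) 48,
      ENNReal.ofReal (nuDensity v) * ‖f v - f w‖ₑ ^ 2 := hm.lintegral_prod_right'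
  obtain ⟨w, hw⟩ := exists_le_lintegral (μ := volume.restrict (Set.Icc (0 : ℝ) 1)) hF.aemeasurable
  refine ⟨w, hw.trans ?_⟩
  rw [lintegral_lintegral_swap (by exact hm.aemeasurable)]
  have hJ' : ∀ v, Measurable fun u => ENNReal.ofReal (jumpDensity v u) * ‖f v - f u‖ₑ ^ 2 := by
    intro v
    have : Measurable fun u => jumpDensity v u := hJ.comp measurable_prodMk_left
    fun_prop
  have hJm : Measurable fun v => ∫⁻ u, ENNReal.ofReal (jumpDensity v u) * ‖f v - f u‖ₑ ^ 2 := by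
    have : Measurable fun p : ℝ × ℝ =>
        ENNReal.ofReal (Function.uncurry jumpDensity p) * ‖f p.1 - f p.2‖ₑ ^ 2 := by fun_prop
    exact this.lintegral_prod_right'
  calc _ ≤ ∫⁻ v in Set.Icc (-16) 48, ∫⁻ u in Set.Icc 0 1,
        ENNReal.ofReal c * (ENNReal.ofReal (jumpDensity v u) * ‖f v - f u‖ₑ ^ 2) := by
        refine setLIntegral_mono' measurableSet_Icc fun v hv => ?_
        refine setLIntegral_mono' measurableSet_Icc fun u hu => ?_
        rw [← mul_assoc, ← ENNReal.ofReal_mul hc0]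
        gcongr
        exact hc v hv u ⟨by linarith [hu.1], by linarith [hu.2]⟩
    _ ≤ ∫⁻ v, ∫⁻ u, ENNReal.ofReal c * (ENNReal.ofReal (jumpDensity v u) * ‖f v - f u‖ₑ ^ 2) := by
        refine (setLIntegral_le_lintegral _ _).trans ?_
        exact lintegral_mono fun v => setLIntegral_le_lintegral _ _
    _ = _ := by
        rw [← lintegral_const_mul _ hJm]
        exact lintegral_congr fun v => lintegral_const_mul _ (hJ' v)

/-- Integrate `|g v|² ≤ 2 |g v - g u|² + 2 |g u|²` against `inwardDensity v u`. The first term is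
bounded by the energy; in the second each point receives at most a quarter of its weight, and `2 / 4
= 1 / 2`. -/
lemma setLIntegral_compl_Icc_le {g : ℝ → ℂ} (hg : Measurable g) :
    ∫⁻ v in (Set.Icc (-16) 48)ᶜ, ENNReal.ofReal (nuDensity v) * ‖g v‖ₑ ^ 2 ≤
      2 * ENNReal.ofReal (24 + Real.exp 16) *
        (∫⁻ v, ∫⁻ u, ENNReal.ofReal (jumpDensity v u) * ‖g v - g u‖ₑ ^ 2) +
      (∫⁻ u, ENNReal.ofReal (nuDensity u) * ‖g u‖ₑ ^ 2) / 2 := by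
  have hρ := measurable_nuDensity
  have hJ := measurable_jumpDensity
  have hI := measurable_inwardDensity
  have hIv : ∀ v, Measurable fun u => inwardDensity v u := fun v => hI.comp measurable_prodMk_left
  have hIu : ∀ u, Measurable fun v => inwardDensity v u := fun u => hI.comp measurable_prodMk_right
  have hJv : ∀ v, Measurable fun u => jumpDensity v u := fun v => hJ.comp measurable_prodMk_left
  have hJm : Measurable fun v => ∫⁻ u, ENNReal.ofReal (jumpDensity v u) * ‖g v - g u‖ₑ ^ 2 := by
    have : Measurable fun p : ℝ × ℝ =>
        ENNReal.ofReal (Function.uncurry jumpDensity p) * ‖g p.1 - g p.2‖ₑ ^ 2 := by fun_prop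
    exact this.lintegral_prod_right'
  have hIg : Measurable fun p : ℝ × ℝ =>
      ENNReal.ofReal (Function.uncurry inwardDensity p) * ‖g p.2‖ₑ ^ 2 := by fun_prop
  have hc : 0 ≤ 24 + Real.exp 16 := by positivity
  calc _ = ∫⁻ v in (Set.Icc (-16) 48)ᶜ, ∫⁻ u, ENNReal.ofReal (inwardDensity v u) * ‖g v‖ₑ ^ 2 := by
        refine setLIntegral_congr_fun measurableSet_Icc.compl fun v hv => ?_
        rw [lintegral_mul_const _ (hIv v).ennreal_ofReal, lintegral_inwardDensity hv]
    _ ≤ ∫⁻ v, ∫⁻ u, ENNReal.ofReal (inwardDensity v u) * ‖g v‖ₑ ^ 2 := setLIntegral_le_lintegral _ _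
    _ ≤ ∫⁻ v, ∫⁻ u, (2 * ENNReal.ofReal (24 + Real.exp 16) *
          (ENNReal.ofReal (jumpDensity v u) * ‖g v - g u‖ₑ ^ 2) +
          2 * (ENNReal.ofReal (inwardDensity v u) * ‖g u‖ₑ ^ 2)) := by
        refine lintegral_mono fun v => lintegral_mono fun u => ?_
        calc _ ≤ ENNReal.ofReal (inwardDensity v u) * (2 * ‖g v - g u‖ₑ ^ 2 + 2 * ‖g u‖ₑ ^ 2) := by
              gcongr; exact enorm_sq_le_add _ _
          _ = 2 * ENNReal.ofReal (inwardDensity v u) * ‖g v - g u‖ₑ ^ 2 +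
              2 * (ENNReal.ofReal (inwardDensity v u) * ‖g u‖ₑ ^ 2) := by ring
          _ ≤ 2 * ENNReal.ofReal ((24 + Real.exp 16) * jumpDensity v u) * ‖g v - g u‖ₑ ^ 2 +
              2 * (ENNReal.ofReal (inwardDensity v u) * ‖g u‖ₑ ^ 2) := by
              gcongr; exact inwardDensity_le v u
          _ = _ := by rw [ENNReal.ofReal_mul hc]; ring
    _ = 2 * ENNReal.ofReal (24 + Real.exp 16) *
          (∫⁻ v, ∫⁻ u, ENNReal.ofReal (jumpDensity v u) * ‖g v - g u‖ₑ ^ 2) +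
          2 * ∫⁻ v, ∫⁻ u, ENNReal.ofReal (inwardDensity v u) * ‖g u‖ₑ ^ 2 := by
        rw [← lintegral_const_mul _ hJm, ← lintegral_const_mul _ (by exact hIg.lintegral_prod_right'),
          ← lintegral_add_left (hJm.const_mul _)]
        refine lintegral_congr fun v => ?_
        have h1 := hJv v
        have h2 := hIv v
        rw [lintegral_add_left (by fun_prop), lintegral_const_mul _ (by fun_prop),
          lintegral_const_mul _ (by fun_prop)]
    _ ≤ _ := by
        gcongr
        rw [lintegral_lintegral_swap (by exact hIg.aemeasurable)]
        calc _ ≤ 2 * ∫⁻ u, ENNReal.ofReal (nuDensity u / 4) * ‖g u‖ₑ ^ 2 := by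
              gcongr with u
              rw [lintegral_mul_const _ (hIu u).ennreal_ofReal]
              gcongr
              exact lintegral_inwardDensity_left_le u
          _ = (∫⁻ u, ENNReal.ofReal (nuDensity u) * ‖g u‖ₑ ^ 2) / 2 := by
              have e : ∀ u, ENNReal.ofReal (nuDensity u / 4) * ‖g u‖ₑ ^ 2 =
                  4⁻¹ * (ENNReal.ofReal (nuDensity u) * ‖g u‖ₑ ^ 2) := fun u => by
                rw [ENNReal.ofReal_div_of_pos (by norm_num), ENNReal.ofReal_ofNat,
                  ENNReal.div_eq_inv_mul, mul_assoc]
              simp only [e]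
              rw [lintegral_const_mul _ (by fun_prop), ← mul_assoc, ENNReal.div_eq_inv_mul]
              congr 1
              rw [show (4 : ℝ≥0∞) = 2 * 2 by norm_num, ENNReal.mul_inv (by simp) (by simp),
                ← mul_assoc, ENNReal.mul_inv_cancel (by simp) (by simp), one_mul]
          _ ≤ _ := le_rfl

/-- The Poincaré inequality for the jump density without line singularity. -/
theorem exists_poincare_jumpDensity : ∃ C : ℝ≥0, ∀ f : ℝ → ℂ, Measurable f →
    ∫⁻ u, ENNReal.ofReal (nuDensity u) * ‖f u‖ₑ ^ 2 < ∞ → ∃ m : ℂ,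
    ∫⁻ u, ENNReal.ofReal (nuDensity u) * ‖f u - m‖ₑ ^ 2 ≤
      C * ∫⁻ v, ∫⁻ u, ENNReal.ofReal (jumpDensity v u) * ‖f v - f u‖ₑ ^ 2 := by
  obtain ⟨C₀, hC₀⟩ := exists_mem_Icc_lintegral_le
  refine ⟨2 * (C₀ + 2 * (24 + Real.exp 16).toNNReal), fun f hf hfin => ?_⟩
  obtain ⟨w, hw⟩ := hC₀ f hf
  refine ⟨f w, ?_⟩
  have hρ := measurable_nuDensity
  have h2 := setLIntegral_compl_Icc_le (g := fun u => f u - f w) (hf.sub_const _)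
  simp only [sub_sub_sub_cancel_right] at h2
  have h3 := lintegral_add_compl (μ := volume)
    (fun v => ENNReal.ofReal (nuDensity v) * ‖f v - f w‖ₑ ^ 2)
    (measurableSet_Icc (a := (-16 : ℝ)) (b := 48))
  -- Finiteness is what permits subtracting half of this integral from both sides below.
  have hXfin : ∫⁻ u, ENNReal.ofReal (nuDensity u) * ‖f u - f w‖ₑ ^ 2 ≠ ∞ := by
    refine ne_top_of_le_ne_top (b := 2 * (∫⁻ u, ENNReal.ofReal (nuDensity u) * ‖f u‖ₑ ^ 2) +
      2 * ‖f w‖ₑ ^ 2 * ∫⁻ u, ENNReal.ofReal (nuDensity u)) ?_ ?_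
    · have := lintegral_nuDensity_lt_top.ne
      have := hfin.ne
      finiteness
    · rw [← lintegral_const_mul _ (by fun_prop), ← lintegral_const_mul _ (by fun_prop),
        ← lintegral_add_left (by fun_prop)]
      refine lintegral_mono fun u => ?_
      have h := enorm_sq_le_add (f u - f w) (-f w)
      rw [sub_neg_eq_add, sub_add_cancel, enorm_neg] at h
      calc _ ≤ ENNReal.ofReal (nuDensity u) * (2 * ‖f u‖ₑ ^ 2 + 2 * ‖f w‖ₑ ^ 2) := by gcongr
        _ = _ := by ring
  generalize (∫⁻ v, ∫⁻ u, ENNReal.ofReal (jumpDensity v u) * ‖f v - f u‖ₑ ^ 2) = D at *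
  generalize (∫⁻ v in (Set.Icc (-16) 48)ᶜ, ENNReal.ofReal (nuDensity v) * ‖f v - f w‖ₑ ^ 2) = Y at *
  generalize (∫⁻ v in Set.Icc (-16) 48, ENNReal.ofReal (nuDensity v) * ‖f v - f w‖ₑ ^ 2) = Z at *
  generalize (∫⁻ u, ENNReal.ofReal (nuDensity u) * ‖f u - f w‖ₑ ^ 2) = X at *
  have h4 : X / 2 + X / 2 ≤ C₀ * D + 2 * ENNReal.ofReal (24 + Real.exp 16) * D + X / 2 := by
    rw [ENNReal.add_halves, ← h3, add_assoc]
    exact add_le_add hw (h3 ▸ h2)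
  have h5 := (ENNReal.add_le_add_iff_right (ENNReal.div_ne_top hXfin (by simp))).1 h4
  calc X = 2 * (X / 2) := by rw [ENNReal.mul_div_cancel (by simp) (by simp)]
    _ ≤ 2 * (C₀ * D + 2 * ENNReal.ofReal (24 + Real.exp 16) * D) := by gcongr
    _ = _ := by push_cast; rw [ENNReal.ofReal]; ring

end Poincare

/-! ### The Dirichlet form and its comparison with the jump density. -/

section Form

/-- Twice the Dirichlet form of the kernel `k`. -/
def energy (k : ℝ → ℝ → ℝ) (f : ℝ → ℂ) : ℝ≥0∞ :=
  ∫⁻ p, ENNReal.ofReal (k p.1 p.2) * ‖f p.1 - f p.2‖ₑ ^ 2 ∂(nu.prod nu)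

lemma lintegral_nu {F : ℝ → ℝ≥0∞} (hF : Measurable F) :
    ∫⁻ u, F u ∂nu = ∫⁻ u, ENNReal.ofReal (nuDensity u) * F u := by
  unfold nu
  rw [lintegral_withDensity_eq_lintegral_mul _ measurable_nuDensity.ennreal_ofReal hF]
  rfl

lemma lintegral_nu_prod {F : ℝ × ℝ → ℝ≥0∞} (hF : Measurable F) :
    ∫⁻ p, F p ∂(nu.prod nu) =
      ∫⁻ p : ℝ × ℝ, ENNReal.ofReal (nuDensity p.1 * nuDensity p.2) * F p := by
  have hm := measurable_nuDensity
  unfold nu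
  rw [prod_withDensity (by fun_prop) (by fun_prop),
    lintegral_withDensity_eq_lintegral_mul _ (by fun_prop) hF]
  refine lintegral_congr fun p => ?_
  rw [Pi.mul_apply, ENNReal.ofReal_mul (nuDensity_nonneg _)]

lemma nuDensity_mul_nuDensity_mul_kernel_mul {u v : ℝ} (h : u ≠ v) :
    nuDensity u * nuDensity v * (kernel 1 u v * (1 - Real.exp (-|u - v|))) =
      4 * jumpDensity u v := by
  have h1 : 1 - Real.exp (-|u - v|) ≠ 0 := by
    have : Real.exp (-|u - v|) < 1 := Real.exp_lt_one_iff.2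
      (neg_neg_of_pos (abs_pos.2 (sub_ne_zero.2 h)))
    linarith
  rw [← mul_assoc, nuDensity_mul_nuDensity_mul_kernel, div_mul_cancel₀ _ h1]

lemma energy_sub_le {k : ℝ → ℝ → ℝ} (hk : Measurable (Function.uncurry k)) {f g : ℝ → ℂ}
    (hf : Measurable f) (hg : Measurable g) :
    energy k (f - g) ≤ 2 * energy k f + 2 * energy k g := by
  have hk' : Measurable fun p : ℝ × ℝ => k p.1 p.2 := hk
  unfold energy
  rw [← lintegral_const_mul _ (by fun_prop), ← lintegral_const_mul _ (by fun_prop),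
    ← lintegral_add_left (by fun_prop)]
  refine lintegral_mono fun p => ?_
  have h := enorm_sq_le_add ((f - g) p.1 - (f - g) p.2) (-(g p.1 - g p.2))
  rw [enorm_neg, show (f - g) p.1 - (f - g) p.2 - -(g p.1 - g p.2) = f p.1 - f p.2 by
    simp only [Pi.sub_apply]; ring] at h
  calc _ ≤ ENNReal.ofReal (k p.1 p.2) * (2 * ‖f p.1 - f p.2‖ₑ ^ 2 + 2 * ‖g p.1 - g p.2‖ₑ ^ 2) := by
        gcongr
    _ = _ := by ring

/-- The Poincaré inequality for a kernel bounded below by the one without line singularity. -/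
lemma exists_poincare {k : ℝ → ℝ → ℝ} (hk : Measurable (Function.uncurry k)) {c : ℝ} (hc : 0 < c)
    (hlow : ∀ u v, c * (kernel 1 u v * (1 - Real.exp (-|u - v|))) ≤ k u v) :
    ∃ C : ℝ≥0, ∀ f : ℝ → ℂ, Measurable f → ∫⁻ u, ‖f u‖ₑ ^ 2 ∂nu < ∞ → ∃ m : ℂ,
      ∫⁻ u, ‖f u - m‖ₑ ^ 2 ∂nu ≤ C * energy k f := by
  obtain ⟨C, hC⟩ := exists_poincare_jumpDensity
  refine ⟨C * (1 / (4 * c)).toNNReal, fun f hf hfin => ?_⟩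
  rw [lintegral_nu (by fun_prop)] at hfin
  obtain ⟨m, hm⟩ := hC f hf hfin
  refine ⟨m, ?_⟩
  rw [lintegral_nu (by fun_prop)]
  refine hm.trans ?_
  push_cast
  rw [mul_assoc]
  gcongr
  have hk' : Measurable fun p : ℝ × ℝ => k p.1 p.2 := hk
  have hJ := measurable_jumpDensity
  have hmeas : Measurable fun p : ℝ × ℝ =>
        ENNReal.ofReal (Function.uncurry jumpDensity p) * ‖f p.1 - f p.2‖ₑ ^ 2 := by fun_prop
  have hρ := measurable_nuDensity
  unfold energy
  rw [lintegral_nu_prod (by fun_prop), ← lintegral_const_mul _ (by fun_prop)]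
  rw [lintegral_lintegral (f := fun v u => ENNReal.ofReal (jumpDensity v u) * ‖f v - f u‖ₑ ^ 2)
    hmeas.aemeasurable]
  refine lintegral_mono fun p => ?_
  -- On the diagonal the kernel comparison degenerates, but the increment of `f` vanishes.
  rcases eq_or_ne p.1 p.2 with h | h
  · simp [h]
  · rw [← mul_assoc, ← mul_assoc, ← ENNReal.ofReal, ← ENNReal.ofReal_mul (by positivity),
      ← ENNReal.ofReal_mul (mul_nonneg (by positivity)
        (mul_nonneg (nuDensity_nonneg _) (nuDensity_nonneg _)))]
    gcongr
    have h1 := nuDensity_mul_nuDensity_mul_kernel_mul h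
    have h2 := mul_le_mul_of_nonneg_left (hlow p.1 p.2)
      (mul_nonneg (nuDensity_nonneg p.1) (nuDensity_nonneg p.2))
    calc jumpDensity p.1 p.2 = 1 / (4 * c) * (c * (4 * jumpDensity p.1 p.2)) := by field_simp
      _ = 1 / (4 * c) * (nuDensity p.1 * nuDensity p.2 *
          (c * (kernel 1 p.1 p.2 * (1 - Real.exp (-|p.1 - p.2|))))) := by rw [← h1]; ring
      _ ≤ 1 / (4 * c) * (nuDensity p.1 * nuDensity p.2 * k p.1 p.2) := by gcongr
      _ = _ := by ring

/-! ### Cut-off functions of vanishing energy. -/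

/-- A piecewise linear cut-off function. -/
def tent (m : ℕ) (u : ℝ) : ℂ := (max 0 (1 - |u| / (m + 1)) : ℝ)

lemma norm_tent_sub_le (m : ℕ) (u v : ℝ) :
    ‖tent m u - tent m v‖ ≤ min 1 (|u - v| / (m + 1)) := by
  unfold tent
  rw [← Complex.ofReal_sub, Complex.norm_real, Real.norm_eq_abs]
  have hm : (0 : ℝ) < m + 1 := by positivity
  have hu : 0 ≤ |u| / (m + 1) := by positivity
  have hv : 0 ≤ |v| / (m + 1) := by positivity
  refine le_min ?_ ?_
  · refine abs_sub_le_iff.2 ⟨?_, ?_⟩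
    · linarith [max_le (zero_le_one' ℝ) (show 1 - |u| / (m + 1) ≤ 1 by linarith),
        le_max_left 0 (1 - |v| / (m + 1))]
    · linarith [max_le (zero_le_one' ℝ) (show 1 - |v| / (m + 1) ≤ 1 by linarith),
        le_max_left 0 (1 - |u| / (m + 1))]
  · refine (abs_max_sub_max_le_abs _ _ _).trans ?_ |> (by simpa only [max_comm (0 : ℝ)] using ·)
    rw [sub_sub_sub_cancel_left, ← sub_div, abs_div, abs_of_pos hm, abs_sub_comm u v]
    exact div_le_div_of_nonneg_right (abs_abs_sub_abs_le v u) hm.le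

lemma norm_tent_le (m : ℕ) (u : ℝ) : ‖tent m u‖ ≤ 1 := by
  have hu : 0 ≤ |u| / (m + 1) := by positivity
  unfold tent
  rw [Complex.norm_real, Real.norm_of_nonneg (le_max_left _ _)]
  exact max_le zero_le_one (by linarith)

lemma tendsto_tent (u : ℝ) : Tendsto (fun m => tent m u) atTop (𝓝 1) := by
  have h1 : Tendsto (fun m : ℕ => |u| / ((m : ℝ) + 1)) atTop (𝓝 0) :=
    tendsto_const_div_atTop_nhds_zero_nat |u| |>.comp (tendsto_add_atTop_nat 1) |>.congr
      fun m => by simp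
  have h2 : Tendsto (fun m : ℕ => max 0 (1 - |u| / ((m : ℝ) + 1))) atTop (𝓝 (max 0 (1 - 0))) :=
    tendsto_const_nhds.max (tendsto_const_nhds.sub h1)
  have h3 := (Complex.continuous_ofReal.tendsto _).comp h2
  simpa [tent, Function.comp_def] using h3

/-- Boundedness is the Hölder condition of exponent `0` and Lipschitz continuity that of exponent
`1`; interpolate. -/
lemma memHolder_of_lipschitz_of_bounded {α : ℝ≥0} (hα1 : α ≤ 1) {g : ℝ → ℂ} {L B : ℝ≥0}
    (hL : LipschitzWith L g) (hB : ∀ u, ‖g u‖ ≤ B) : MemHolder α g := by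
  have h0 : HolderWith (2 * B) 0 g := fun u v => by
    rw [NNReal.coe_zero, ENNReal.rpow_zero, mul_one, edist_dist, ENNReal.ofReal_le_iff_le_toReal
      ENNReal.coe_ne_top, dist_eq_norm]
    refine (norm_sub_le _ _).trans ?_
    push_cast
    simp
    linarith [hB u, hB v]
  exact ⟨_, h0.of_le_of_le (holderWith_one.2 hL) (zero_le) hα1⟩

lemma isHolderCc_tent {α : ℝ≥0} (hα1 : α ≤ 1) (m : ℕ) : IsHolderCc α (tent m) := by
  constructor
  · refine memHolder_of_lipschitz_of_bounded hα1 (L := 1) (B := 1) ?_ (norm_tent_le m)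
    refine LipschitzWith.of_dist_le_mul fun u v => ?_
    rw [dist_eq_norm, Real.dist_eq, NNReal.coe_one, one_mul]
    refine (norm_tent_sub_le m u v).trans ((min_le_right _ _).trans ?_)
    exact div_le_self (abs_nonneg _) (by linarith [(Nat.cast_nonneg m : (0 : ℝ) ≤ m)])
  · refine HasCompactSupport.intro (isCompact_closedBall (0 : ℝ) (m + 1)) fun u hu => ?_
    rw [Metric.mem_closedBall, dist_zero_right, Real.norm_eq_abs, not_le] at hu
    have : 1 ≤ |u| / (m + 1) := by
      rw [le_div_iff₀ (by positivity), one_mul]; exact hu.le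
    rw [tent, max_eq_left (by linarith), Complex.ofReal_zero]

lemma measurable_tent (m : ℕ) : Measurable (tent m) := by
  unfold tent; fun_prop

/-- With `r = |u - v|`, the squared increment of every tent is at most `min 1 r ^ 2 ≤ 2 (1 - exp
(-r))`, which cancels the line singularity and leaves the integrable majorant `8 c * jumpDensity`.
Increments tend to `0` pointwise, so dominated convergence applies. -/
lemma tendsto_energy_tent {k : ℝ → ℝ → ℝ} (hk : Measurable (Function.uncurry k)) {c : ℝ}
    (hc : 0 ≤ c) (hb : ∀ u v, |k u v| ≤ c * kernel 1 u v) :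
    Tendsto (fun m => energy k (tent m)) atTop (𝓝 0) := by
  have hk' : Measurable fun p : ℝ × ℝ => k p.1 p.2 := hk
  have hk1 : Measurable fun p : ℝ × ℝ => kernel 1 p.1 p.2 := measurable_kernel 1
  have ht := measurable_tent
  have hlim : Tendsto (fun m => energy k (tent m)) atTop (𝓝 (∫⁻ _, 0 ∂(nu.prod nu))) := by
    refine tendsto_lintegral_of_dominated_convergence
      (fun p => ENNReal.ofReal (c * (kernel 1 p.1 p.2 * (2 * (1 - Real.exp (-|p.1 - p.2|))))))
      (fun m => by fun_prop) (fun m => ae_of_all _ fun p => ?_) ?_ (ae_of_all _ fun p => ?_)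
    · have h1 := norm_tent_sub_le m p.1 p.2
      have hr := abs_nonneg (p.1 - p.2)
      have hK := kernel_nonneg zero_le_one p.1 p.2
      have h2 : |p.1 - p.2| / (m + 1) ≤ |p.1 - p.2| :=
        div_le_self hr (by linarith [(Nat.cast_nonneg m : (0 : ℝ) ≤ m)])
      have h3 := (hb p.1 p.2)
      beta_reduce
      rw [← ofReal_norm, ← ENNReal.ofReal_pow (norm_nonneg _), ← ENNReal.ofReal_mul' (by positivity)]
      refine ENNReal.ofReal_le_ofReal ?_
      generalize |p.1 - p.2| = r at *
      have h4 : ‖tent m p.1 - tent m p.2‖ ≤ min 1 r := h1.trans (min_le_min_left _ h2)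
      have h5 : (min 1 r) ^ 2 ≤ 2 * (1 - Real.exp (-r)) := by
        have h6 : Real.exp (-r) ≤ 1 / (1 + r) := by
          rw [Real.exp_neg, inv_eq_one_div]
          gcongr
          linarith [Real.add_one_le_exp r]
        have h7 : 2 * (1 - 1 / (1 + r)) ≤ 2 * (1 - Real.exp (-r)) := by linarith
        refine le_trans ?_ h7
        have e : 2 * (1 - 1 / (1 + r)) = 2 * r / (1 + r) := by field_simp; ring
        rw [e, le_div_iff₀ (by positivity)]
        rcases le_total 1 r with h | h
        · rw [min_eq_left h]; linarith
        · rw [min_eq_right h]; nlinarith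
      calc _ ≤ c * kernel 1 p.1 p.2 * (2 * (1 - Real.exp (-r))) := by
            gcongr
            · exact (le_abs_self _).trans h3
            · exact le_trans (by gcongr) h5
        _ = _ := by ring
    · rw [lintegral_nu_prod (by fun_prop)]
      refine ne_top_of_le_ne_top (b := ENNReal.ofReal (8 * c) *
        ∫⁻ p : ℝ × ℝ, ENNReal.ofReal (jumpDensity p.1 p.2)) ?_ ?_
      · exact ENNReal.mul_ne_top ENNReal.ofReal_ne_top lintegral_jumpDensity_lt_top.ne
      · have hJm : Measurable fun p : ℝ × ℝ => jumpDensity p.1 p.2 := measurable_jumpDensity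
        rw [← lintegral_const_mul _ hJm.ennreal_ofReal]
        refine lintegral_mono fun p => ?_
        rw [← ENNReal.ofReal_mul (mul_nonneg (nuDensity_nonneg _) (nuDensity_nonneg _)),
          ← ENNReal.ofReal_mul (by positivity)]
        refine ENNReal.ofReal_le_ofReal ?_
        have hJ := jumpDensity_pos p.1 p.2
        rcases eq_or_ne p.1 p.2 with h | h
        · rw [h] at hJ ⊢
          simp only [sub_self, abs_zero, neg_zero, Real.exp_zero, mul_zero]
          positivity
        · have := nuDensity_mul_nuDensity_mul_kernel_mul h
          refine le_of_eq ?_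
          calc _ = 2 * c * (nuDensity p.1 * nuDensity p.2 *
                (kernel 1 p.1 p.2 * (1 - Real.exp (-|p.1 - p.2|)))) := by ring
            _ = _ := by rw [this]; ring
    · have h1 : Tendsto (fun m => tent m p.1 - tent m p.2) atTop (𝓝 0) := by
        simpa using (tendsto_tent p.1).sub (tendsto_tent p.2)
      have h2 : Tendsto (fun m => ‖tent m p.1 - tent m p.2‖ₑ ^ 2) atTop (𝓝 0) := by
        have := (ENNReal.continuous_pow 2).tendsto _ |>.comp ((continuous_enorm.tendsto _).comp h1)
        simpa [Function.comp_def] using this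
      have h3 := ENNReal.Tendsto.const_mul (a := ENNReal.ofReal (k p.1 p.2)) h2
        (Or.inr ENNReal.ofReal_ne_top)
      simpa using h3
  simpa using hlim

end Form

/-! ### The operator on compactly supported Hölder functions. -/

section Core

lemma dense_coreDomain {α : ℝ≥0} (hα1 : α ≤ 1) : Dense (coreDomain α : Set H) := by
  refine (Lp.dense_hasCompactSupport_contDiff (F := ℂ) (μ := nu) (p := 2) (by simp)).mono ?_
  rintro f ⟨g, hfg, hc, hs⟩
  obtain ⟨L, hL⟩ := hs.lipschitzWith_of_hasCompactSupport hc (by simp)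
  obtain ⟨B, hB⟩ := hs.continuous.bounded_above_of_compact_support hc
  refine ⟨g, ⟨memHolder_of_lipschitz_of_bounded hα1 (B := B.toNNReal) hL fun u => ?_, hc⟩, hfg⟩
  exact (hB u).trans (Real.le_coe_toNNReal B)

variable {k : ℝ → ℝ → ℝ} {c : ℝ} {α : ℝ≥0} {g h : ℝ → ℂ}

lemma IsHolderCc.continuous (hα : 0 < α) (hg : IsHolderCc α g) : Continuous g :=
  hg.1.choose_spec.continuous hα

lemma IsHolderCc.exists_bound (hα : 0 < α) (hg : IsHolderCc α g) : ∃ B, ∀ u, ‖g u‖ ≤ B :=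
  (hg.continuous hα).bounded_above_of_compact_support hg.2

lemma coreOp_coeFn (hk : Measurable (Function.uncurry k))
    (hb : ∃ c, ∀ u v, |k u v| ≤ c * kernel 1 u v) (hα : 0 < α) (φ : (coreOp k hk hb α hα).domain)
    (hφ : (φ : H) =ᵐ[nu] g) : coreOp k hk hb α hα φ =ᵐ[nu] diffIntegral k g := by
  obtain ⟨f, hf, hφf⟩ := φ.2
  exact (MemLp.coeFn_toLp ((memLp_diffIntegral hk hb.choose_spec hα hf).ae_eq
    (diffIntegral_congr k hφf).symm)).trans (diffIntegral_congr k hφ)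

/-- The inner integrals are bounded uniformly in `u` and `ν` is finite. This justifies Fubini in the
symmetrization. -/
lemma integrable_prod_diff (hk : Measurable (Function.uncurry k))
    (hb : ∀ u v, |k u v| ≤ c * kernel 1 u v) (hα : 0 < α) (hg : IsHolderCc α g) :
    Integrable (fun p : ℝ × ℝ => (k p.1 p.2 : ℂ) * (g p.1 - g p.2)) (nu.prod nu) := by
  have hk' : Measurable fun p : ℝ × ℝ => k p.1 p.2 := hk
  have hgm := (hg.continuous hα).measurable
  have hm : Measurable fun p : ℝ × ℝ => (k p.1 p.2 : ℂ) * (g p.1 - g p.2) := by fun_prop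
  refine ⟨hm.aestronglyMeasurable, ?_⟩
  obtain ⟨M, hM⟩ := exists_lintegral_le hb hα hg
  rw [hasFiniteIntegral_iff_enorm, lintegral_prod _ (by fun_prop)]
  calc _ ≤ ∫⁻ _, (M : ℝ≥0∞) ∂nu := lintegral_mono fun u => hM u
    _ < ∞ := by
      rw [lintegral_const]
      exact ENNReal.mul_lt_top ENNReal.coe_lt_top (measure_lt_top _ _)

lemma integrable_prod_diff_mul (hk : Measurable (Function.uncurry k))
    (hb : ∀ u v, |k u v| ≤ c * kernel 1 u v) (hα : 0 < α) (hg : IsHolderCc α g)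
    {F : ℝ × ℝ → ℂ} (hF : Measurable F) {B : ℝ} (hB : ∀ p, ‖F p‖ ≤ B) :
    Integrable (fun p : ℝ × ℝ => (k p.1 p.2 : ℂ) * (g p.1 - g p.2) * F p) (nu.prod nu) :=
  (integrable_prod_diff hk hb hα hg).mul_bdd hF.aestronglyMeasurable (ae_of_all _ hB)

/-- The symmetrized form of the operator. -/
lemma integral_diffIntegral_mul_conj (hk : Measurable (Function.uncurry k))
    (hb : ∀ u v, |k u v| ≤ c * kernel 1 u v) (hsym : ∀ u v, k u v = k v u) (hα : 0 < α)
    (hg : IsHolderCc α g) (hh : Measurable h) {B : ℝ} (hB : ∀ u, ‖h u‖ ≤ B) :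
    ∫ u, diffIntegral k g u * starRingEnd ℂ (h u) ∂nu = (1 / 2) *
      ∫ p : ℝ × ℝ, (k p.1 p.2 : ℂ) * (g p.1 - g p.2) * starRingEnd ℂ (h p.1 - h p.2)
        ∂(nu.prod nu) := by
  have hc : Measurable fun u => starRingEnd ℂ (h u) := Complex.continuous_conj.measurable.comp hh
  have i1 := integrable_prod_diff_mul hk hb hα hg (F := fun p => starRingEnd ℂ (h p.1))
    (by fun_prop) (B := B) (fun p => by rw [RCLike.norm_conj]; exact hB _)
  have i2 := integrable_prod_diff_mul hk hb hα hg (F := fun p => starRingEnd ℂ (h p.2))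
    (by fun_prop) (B := B) (fun p => by rw [RCLike.norm_conj]; exact hB _)
  have e1 : ∫ u, diffIntegral k g u * starRingEnd ℂ (h u) ∂nu =
      ∫ p : ℝ × ℝ, (k p.1 p.2 : ℂ) * (g p.1 - g p.2) * starRingEnd ℂ (h p.1) ∂(nu.prod nu) := by
    rw [integral_prod _ i1]
    congr 1; ext u
    unfold diffIntegral
    rw [← integral_mul_const]
  -- Swapping the variables fixes `k` and changes the sign of the increment of `g`.
  have e2 : ∫ p : ℝ × ℝ, (k p.1 p.2 : ℂ) * (g p.1 - g p.2) * starRingEnd ℂ (h p.1) ∂(nu.prod nu) =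
      -∫ p : ℝ × ℝ, (k p.1 p.2 : ℂ) * (g p.1 - g p.2) * starRingEnd ℂ (h p.2) ∂(nu.prod nu) := by
    rw [← integral_prod_swap, ← integral_neg]
    congr 1; ext p
    simp only [Prod.fst_swap, Prod.snd_swap]
    rw [hsym p.2 p.1]; ring
  have e3 : ∫ p : ℝ × ℝ, (k p.1 p.2 : ℂ) * (g p.1 - g p.2) * starRingEnd ℂ (h p.1 - h p.2)
        ∂(nu.prod nu) =
      ∫ p : ℝ × ℝ, (k p.1 p.2 : ℂ) * (g p.1 - g p.2) * starRingEnd ℂ (h p.1) ∂(nu.prod nu) -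
      ∫ p : ℝ × ℝ, (k p.1 p.2 : ℂ) * (g p.1 - g p.2) * starRingEnd ℂ (h p.2) ∂(nu.prod nu) := by
    rw [← integral_sub i1 i2]
    congr 1; ext p
    rw [map_sub]; ring
  rw [e3, e1]
  linear_combination (1 / 2 : ℂ) * e2

/-- The test vector need not lie in the core. Taking it constant, the right side vanishes, so the
range of the operator is orthogonal to constants. -/
lemma inner_coreOp (hk : Measurable (Function.uncurry k))
    (hb : ∃ c, ∀ u v, |k u v| ≤ c * kernel 1 u v) (hsym : ∀ u v, k u v = k v u) (hα : 0 < α)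
    (φ : (coreOp k hk hb α hα).domain) (hg : IsHolderCc α g) (hφ : (φ : H) =ᵐ[nu] g)
    {ψ : H} (hψ : ψ =ᵐ[nu] h) (hh : Measurable h) {B : ℝ} (hB : ∀ u, ‖h u‖ ≤ B) :
    inner ℂ ψ (coreOp k hk hb α hα φ) = (1 / 2) *
      ∫ p : ℝ × ℝ, (k p.1 p.2 : ℂ) * (g p.1 - g p.2) * starRingEnd ℂ (h p.1 - h p.2)
        ∂(nu.prod nu) := by
  rw [← integral_diffIntegral_mul_conj hk hb.choose_spec hsym hα hg hh hB, L2.inner_def]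
  refine integral_congr_ae ?_
  filter_upwards [hψ, coreOp_coeFn hk hb hα φ hφ] with u h1 h2
  rw [h1, h2, RCLike.inner_apply]

lemma isFormalAdjoint_coreOp (hk : Measurable (Function.uncurry k))
    (hb : ∃ c, ∀ u v, |k u v| ≤ c * kernel 1 u v) (hsym : ∀ u v, k u v = k v u) (hα : 0 < α) :
    (coreOp k hk hb α hα).IsFormalAdjoint (coreOp k hk hb α hα) := by
  intro φ ψ
  obtain ⟨f, hf, hφ⟩ := φ.2
  obtain ⟨g, hg, hψ⟩ := ψ.2
  obtain ⟨B₁, hB₁⟩ := hf.exists_bound hα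
  obtain ⟨B₂, hB₂⟩ := hg.exists_bound hα
  rw [← inner_conj_symm, inner_coreOp hk hb hsym hα φ hf hφ hψ (hg.continuous hα).measurable hB₂,
    inner_coreOp hk hb hsym hα ψ hg hψ hφ (hf.continuous hα).measurable hB₁, map_mul,
    ← integral_conj]
  congr 1
  · rw [map_div₀, map_one, map_ofNat]
  · congr 1; ext p
    simp only [map_mul, Complex.conj_ofReal, Complex.conj_conj]
    ring

lemma inner_coreOp_self (hk : Measurable (Function.uncurry k))
    (hb : ∃ c, ∀ u v, |k u v| ≤ c * kernel 1 u v) (hsym : ∀ u v, k u v = k v u)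
    (hpos : ∀ u v, 0 ≤ k u v) (hα : 0 < α) (φ : (coreOp k hk hb α hα).domain)
    (hg : IsHolderCc α g) (hφ : (φ : H) =ᵐ[nu] g) :
    energy k g < ∞ ∧
      inner ℂ (φ : H) (coreOp k hk hb α hα φ) = ((1 / 2 * (energy k g).toReal : ℝ) : ℂ) := by
  obtain ⟨B, hB⟩ := hg.exists_bound hα
  have hgm := (hg.continuous hα).measurable
  have hk' : Measurable fun p : ℝ × ℝ => k p.1 p.2 := hk
  have e : ∀ p : ℝ × ℝ, (k p.1 p.2 : ℂ) * (g p.1 - g p.2) * starRingEnd ℂ (g p.1 - g p.2) =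
      ((k p.1 p.2 * ‖g p.1 - g p.2‖ ^ 2 : ℝ) : ℂ) := fun p => by
    rw [mul_assoc, Complex.mul_conj, Complex.normSq_eq_norm_sq]; push_cast; ring
  have hi := integrable_prod_diff_mul hk hb.choose_spec hα hg
    (F := fun p => starRingEnd ℂ (g p.1 - g p.2)) (B := B + B)
    (Complex.continuous_conj.measurable.comp (by fun_prop)) (fun p => by
      rw [RCLike.norm_conj]
      exact (norm_sub_le _ _).trans (add_le_add (hB _) (hB _)))
  simp only [e] at hi
  have hi' : Integrable (fun p : ℝ × ℝ => k p.1 p.2 * ‖g p.1 - g p.2‖ ^ 2) (nu.prod nu) := by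
    simpa only [RCLike.re_to_complex, Complex.ofReal_re] using hi.re
  have hE : energy k g =
      ENNReal.ofReal (∫ p : ℝ × ℝ, k p.1 p.2 * ‖g p.1 - g p.2‖ ^ 2 ∂(nu.prod nu)) := by
    rw [ofReal_integral_eq_lintegral_ofReal hi' (ae_of_all _ fun p => by
      have := hpos p.1 p.2; positivity)]
    refine lintegral_congr fun p => ?_
    rw [ENNReal.ofReal_mul (hpos _ _), ENNReal.ofReal_pow (norm_nonneg _), ofReal_norm]
  refine ⟨hE ▸ ENNReal.ofReal_lt_top, ?_⟩
  rw [inner_coreOp hk hb hsym hα φ hg hφ hφ hgm hB, hE, ENNReal.toReal_ofReal (integral_nonneg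
    fun p => mul_nonneg (hpos _ _) (by positivity))]
  simp only [e]
  rw [integral_complex_ofReal]
  push_cast; ring

lemma enorm_sq_eq_lintegral {F : H} {f : ℝ → ℂ} (hF : F =ᵐ[nu] f) :
    ‖F‖ₑ ^ 2 = ∫⁻ u, ‖f u‖ₑ ^ 2 ∂nu := by
  have h := eLpNorm_nnreal_pow_eq_lintegral (f := F) (μ := nu) (p := 2) (by norm_num)
  rw [Lp.enorm_def]
  have h2 : ∫⁻ u, ‖F u‖ₑ ^ 2 ∂nu = ∫⁻ u, ‖f u‖ₑ ^ 2 ∂nu := by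
    refine lintegral_congr_ae ?_
    filter_upwards [hF] with u hu
    rw [hu]
  simp only [NNReal.coe_ofNat, ENNReal.rpow_two, ENNReal.coe_ofNat] at h
  rw [h, h2]

/-! ### Constants in the form domain, and the general theorem. -/

lemma nu_ne_zero : nu ≠ 0 := by
  intro h
  have h1 : (volume : Measure ℝ) ≪ nu := by
    refine withDensity_absolutelyContinuous' measurable_nuDensity.ennreal_ofReal.aemeasurable
      (ae_of_all _ fun u => ?_)
    rw [ne_eq, ENNReal.ofReal_eq_zero, not_le]
    exact mul_pos (Real.exp_pos _) (Real.rpow_pos_of_pos (softplus_pos u) _)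
  have h2 := h1 (s := Set.univ) (by rw [h]; simp)
  simp at h2

/-- The constant functions in `L²(ν)`. -/
def constL2 (c : ℂ) : H := Lp.const 2 nu c

lemma constL2_coeFn (c : ℂ) : constL2 c =ᵐ[nu] fun _ => c := Lp.coeFn_const 2 nu c

lemma constL2_smul (a c : ℂ) : a • constL2 c = constL2 (a * c) := by
  refine Lp.ext ?_
  filter_upwards [Lp.coeFn_smul a (constL2 c), constL2_coeFn c, constL2_coeFn (a * c)] with u h1 h2 h3
  rw [h1, h3, Pi.smul_apply, h2, smul_eq_mul]

lemma constL2_one_ne_zero : constL2 1 ≠ 0 := by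
  intro h
  have h1 := constL2_coeFn 1
  rw [h] at h1
  have h2 : ∀ᵐ u ∂nu, False := by
    filter_upwards [h1, Lp.coeFn_zero ℂ 2 nu] with u h1 h2
    rw [h2] at h1
    exact zero_ne_one h1
  rw [ae_iff] at h2
  simp only [not_false_eq_true] at h2
  exact nu_ne_zero (Measure.measure_univ_eq_zero.1 (by simpa using h2))

lemma constL2_mem_formDomain (hk : Measurable (Function.uncurry k))
    (hb : ∃ c, ∀ u v, |k u v| ≤ c * kernel 1 u v) (hsym : ∀ u v, k u v = k v u)
    (hpos : ∀ u v, 0 ≤ k u v) (hα : 0 < α) (hα1 : α ≤ 1) :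
    constL2 1 ∈ formDomain (coreOp k hk hb α hα) := by
  have hmem : ∀ m, MemLp (tent m) 2 nu := fun m =>
    MemLp.of_bound (measurable_tent m).aestronglyMeasurable 1 (ae_of_all _ (norm_tent_le m))
  have hcoe : ∀ m, (hmem m).toLp (tent m) =ᵐ[nu] tent m := fun m => (hmem m).coeFn_toLp
  refine ⟨fun m => ⟨(hmem m).toLp (tent m), tent m, isHolderCc_tent hα1 m, hcoe m⟩, ?_, ?_⟩
  · rw [tendsto_iff_edist_tendsto_0]
    have hlim : Tendsto (fun m => ∫⁻ u, ‖tent m u - 1‖ₑ ^ 2 ∂nu) atTop (𝓝 (∫⁻ _, 0 ∂nu)) := by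
      have ht := measurable_tent
      refine tendsto_lintegral_of_dominated_convergence (fun _ => 4) (fun m => by fun_prop)
        (fun m => ae_of_all _ fun u => ?_) ?_ (ae_of_all _ fun u => ?_)
      · have h1 : ‖tent m u - 1‖ ≤ 2 := by
          refine (norm_sub_le _ _).trans ?_
          rw [norm_one]; linarith [norm_tent_le m u]
        beta_reduce
        rw [← ofReal_norm, ← ENNReal.ofReal_pow (norm_nonneg _), ← ENNReal.ofReal_ofNat]
        refine ENNReal.ofReal_le_ofReal ?_
        nlinarith [norm_nonneg (tent m u - 1)]
      · rw [lintegral_const]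
        exact ENNReal.mul_ne_top (by simp) (measure_ne_top _ _)
      · have h1 : Tendsto (fun m => tent m u - 1) atTop (𝓝 0) := by
          simpa using (tendsto_tent u).sub_const 1
        have := (ENNReal.continuous_pow 2).tendsto _ |>.comp ((continuous_enorm.tendsto _).comp h1)
        simpa [Function.comp_def] using this
    rw [lintegral_zero] at hlim
    have h2 : Tendsto (fun m => (∫⁻ u, ‖tent m u - 1‖ₑ ^ 2 ∂nu) ^ (1 / 2 : ℝ)) atTop (𝓝 0) := by
      have := (ENNReal.continuous_rpow_const (y := 1 / 2)).tendsto _ |>.comp hlim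
      simpa [Function.comp_def] using this
    refine h2.congr fun m => ?_
    have h3 : (hmem m).toLp (tent m) - constL2 1 =ᵐ[nu] fun u => tent m u - 1 := by
      filter_upwards [Lp.coeFn_sub ((hmem m).toLp (tent m)) (constL2 1), hcoe m, constL2_coeFn 1]
        with u h1 h2 h3
      rw [h1, Pi.sub_apply, h2, h3]
    rw [edist_eq_enorm_sub, ← enorm_sq_eq_lintegral h3, ← ENNReal.rpow_natCast, ← ENNReal.rpow_mul]
    norm_num
  · have hE := tendsto_energy_tent hk (c := |hb.choose|) (abs_nonneg _) fun u v =>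
      (hb.choose_spec u v).trans (mul_le_mul_of_nonneg_right (le_abs_self _)
        (kernel_nonneg zero_le_one u v))
    -- The energy of a difference is at most twice the sum of the energies, each of which tends to
    -- `0`.
    have hE2 : Tendsto (fun p : ℕ × ℕ => energy k (tent p.1 - tent p.2)) atTop (𝓝 0) := by
      have h1 : Tendsto (fun p : ℕ × ℕ => 2 * energy k (tent p.1) + 2 * energy k (tent p.2))
          atTop (𝓝 (2 * 0 + 2 * 0)) := by
        rw [← prod_atTop_atTop_eq]
        exact (ENNReal.Tendsto.const_mul (hE.comp tendsto_fst) (by simp)).add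
          (ENNReal.Tendsto.const_mul (hE.comp tendsto_snd) (by simp))
      simp only [mul_zero, add_zero] at h1
      exact tendsto_of_tendsto_of_tendsto_of_le_of_le tendsto_const_nhds h1 (fun _ => zero_le)
        fun p => energy_sub_le hk (measurable_tent _) (measurable_tent _)
    have hE3 : Tendsto (fun p : ℕ × ℕ =>
        ((1 / 2 * (energy k (tent p.1 - tent p.2)).toReal : ℝ) : ℂ)) atTop (𝓝 0) := by
      have h1 := (ENNReal.tendsto_toReal ENNReal.zero_ne_top).comp hE2
      have h2 := (Complex.continuous_ofReal.tendsto _).comp (h1.const_mul (1 / 2))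
      simpa [Function.comp_def] using h2
    refine hE3.congr fun p => ?_
    refine (inner_coreOp_self hk hb hsym hpos hα _ ?_ ?_).2.symm
    · exact ⟨by
        have h1 := (isHolderCc_tent hα1 p.1 (α := α)).1
        have h2 := (isHolderCc_tent hα1 p.2 (α := α)).1.smul (c := (-1 : ℂ))
        simpa [sub_eq_add_neg] using h1.add h2,
        (isHolderCc_tent hα1 p.1 (α := α)).2.sub (isHolderCc_tent hα1 p.2 (α := α)).2⟩
    · exact (Lp.coeFn_sub _ _).trans ((hcoe p.1).sub (hcoe p.2))

lemma smul_mem_formDomain {E : Type*} [NormedAddCommGroup E] [InnerProductSpace ℂ E]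
    {T : E →ₗ.[ℂ] E} {ψ : E} (h : ψ ∈ formDomain T) (a : ℂ) : a • ψ ∈ formDomain T := by
  obtain ⟨φ, h1, h2⟩ := h
  refine ⟨fun m => a • φ m, h1.const_smul a, ?_⟩
  have h3 := h2.const_mul (starRingEnd ℂ a * a)
  rw [mul_zero] at h3
  refine h3.congr fun p => ?_
  rw [← smul_sub, LinearPMap.map_smul, Submodule.coe_smul, inner_smul_left, inner_smul_right,
    mul_assoc]

/-- The Friedrichs extension, the kernel, the spectral gap and the semigroup for a symmetric
non-negative kernel bounded above by the unregularized kernel and below by the one without line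
singularity. -/
theorem exists_friedrichsExtension_coreOp (hk : Measurable (Function.uncurry k))
    (hb : ∃ c, ∀ u v, |k u v| ≤ c * kernel 1 u v) (hsym : ∀ u v, k u v = k v u)
    (hc : 0 < c) (hlow : ∀ u v, c * (kernel 1 u v * (1 - Real.exp (-|u - v|))) ≤ k u v)
    (hα : 0 < α) (hα1 : α ≤ 1) :
    ∃ A : H →ₗ.[ℂ] H, IsFriedrichsExtension (coreOp k hk hb α hα) A ∧ IsSelfAdjoint A ∧
      (∀ ψ : A.domain, 0 ≤ (inner ℂ (ψ : H) (A ψ)).re) ∧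
      (∀ ψ : H, (ψ, (0 : H)) ∈ A.graph ↔ ∃ c : ℂ, ψ =ᵐ[nu] fun _ => c) ∧ HasSpectralGap A ∧
      ∃ S : ℝ≥0 → H →L[ℂ] H, IsContractionSemigroup S ∧ IsGeneratedBy S A := by
  have hpos : ∀ u v, 0 ≤ k u v := fun u v => by
    refine le_trans (mul_nonneg hc.le (mul_nonneg (kernel_nonneg zero_le_one u v) ?_)) (hlow u v)
    rw [sub_nonneg, Real.exp_le_one_iff]; simp
  have hne : (‖constL2 1‖ : ℂ) ≠ 0 := by
    exact_mod_cast norm_ne_zero_iff.2 constL2_one_ne_zero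
  obtain ⟨e, he⟩ : ∃ e : H, e = (‖constL2 1‖ : ℂ)⁻¹ • constL2 1 := ⟨_, rfl⟩
  have he1 : ‖e‖ = 1 := by
    rw [he, norm_smul, norm_inv, Complex.norm_real, norm_norm,
      inv_mul_cancel₀ (norm_ne_zero_iff.2 constL2_one_ne_zero)]
  have hconst : ∀ a, constL2 a = (a * ‖constL2 1‖) • e := fun a => by
    rw [he, smul_smul, mul_assoc, mul_inv_cancel₀ hne, mul_one, constL2_smul, mul_one]
  obtain ⟨C, hC⟩ := exists_poincare hk hc hlow
  have hquad : ∀ φ : (coreOp k hk hb α hα).domain,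
      0 ≤ (inner ℂ (φ : H) (coreOp k hk hb α hα φ)).re := fun φ => by
    obtain ⟨g, hg, hφ⟩ := φ.2
    rw [(inner_coreOp_self hk hb hsym hpos hα φ hg hφ).2, Complex.ofReal_re]
    positivity
  obtain ⟨A, h1, h2, h3, h4, h5⟩ := exists_friedrichsExtension_of_poincare
    -- The quadratic form is half the energy, hence `2 * C`; the `+ 1` keeps the denominator
    -- positive when `C = 0`.
    (T := coreOp k hk hb α hα) (e := e) (δ := 1 / (2 * C + 1)) (dense_coreDomain hα1)
    (isFormalAdjoint_coreOp hk hb hsym hα) hquad he1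
    (he ▸ smul_mem_formDomain (constL2_mem_formDomain hk hb hsym hpos hα hα1) _)
    (fun φ => by
      obtain ⟨g, hg, hφ⟩ := φ.2
      have h := inner_coreOp hk hb hsym hα φ hg hφ (constL2_coeFn 1) measurable_const (B := 1)
        (fun _ => by simp)
      simp only [sub_self, map_zero, mul_zero, integral_zero] at h
      rw [he, inner_smul_right, ← inner_conj_symm, h, map_zero, mul_zero])
    (by positivity)
    (fun φ => by
      obtain ⟨g, hg, hφ⟩ := φ.2
      obtain ⟨hfin, hin⟩ := inner_coreOp_self hk hb hsym hpos hα φ hg hφ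
      have hq := hquad φ
      have hL2 : ∫⁻ u, ‖g u‖ₑ ^ 2 ∂nu < ∞ := by
        rw [← enorm_sq_eq_lintegral hφ]
        exact ENNReal.pow_lt_top enorm_lt_top
      obtain ⟨m, hm⟩ := hC g (hg.continuous hα).measurable hL2
      have hsub : (φ : H) - constL2 m =ᵐ[nu] fun u => g u - m := by
        filter_upwards [Lp.coeFn_sub (φ : H) (constL2 m), hφ, constL2_coeFn m] with u h1 h2 h3
        rw [h1, Pi.sub_apply, h2, h3]
      rw [← enorm_sq_eq_lintegral hsub] at hm
      have hm' : ‖(φ : H) - constL2 m‖ ^ 2 ≤ C * (energy k g).toReal := by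
        have := ENNReal.toReal_mono (ENNReal.mul_ne_top ENNReal.coe_ne_top hfin.ne) hm
        simpa using this
      -- The projection is the best approximation by constants, so the `m` of the Poincaré
      -- inequality need not be the mean.
      have hP : ‖(φ : H) - lineProj e φ‖ ≤ ‖(φ : H) - constL2 m‖ := by
        have h := norm_sub_lineProj_le he1 ((φ : H) - constL2 m)
        have h' : lineProj e (constL2 m) = constL2 m := by
          rw [hconst m, map_smul, lineProj_apply, inner_self_eq_norm_sq_to_K, he1]
          simp
        rwa [map_sub, h', sub_sub_sub_cancel_right] at h
      have hE : (energy k g).toReal = 2 * (inner ℂ (φ : H) (coreOp k hk hb α hα φ)).re := by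
        rw [hin, Complex.ofReal_re]; ring
      rw [hE] at hm'
      have hsq := pow_le_pow_left₀ (norm_nonneg _) hP 2
      rw [div_mul_eq_mul_div, one_mul, div_le_iff₀ (by positivity)]
      linarith)
  refine ⟨A, h1, h2, h3, fun ψ => ?_, h5⟩
  rw [h4]
  constructor
  · rintro ⟨a, rfl⟩
    rw [he, smul_smul, constL2_smul]
    exact ⟨_, constL2_coeFn _⟩
  · rintro ⟨a, ha⟩
    refine ⟨a * ‖constL2 1‖, ?_⟩
    rw [← hconst]
    exact Lp.ext (ha.trans (constL2_coeFn a).symm)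

/-! ### Verification for the two kernels. -/

lemma kernel_comm (n u v : ℝ) : kernel n u v = kernel n v u := by
  unfold kernel
  rw [abs_sub_comm, max_comm, min_comm, mul_comm (softplus u)]

lemma kernelReg_comm (n ε₀ μ' γ₀ a₁ u v : ℝ) :
    kernelReg n ε₀ μ' γ₀ a₁ u v = kernelReg n ε₀ μ' γ₀ a₁ v u := by
  unfold kernelReg cutoff
  rw [kernel_comm, abs_sub_comm, max_comm u v]

lemma kernel_eq_mul (n u v : ℝ) : kernel n u v = n * kernel 1 u v := by
  unfold kernel; ring

lemma mul_kernel_le_kernel {n : ℝ} (hn : 0 < n) (u v : ℝ) :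
    n * (kernel 1 u v * (1 - Real.exp (-|u - v|))) ≤ kernel n u v := by
  rw [kernel_eq_mul n]
  gcongr
  exact mul_le_of_le_one_right (kernel_nonneg zero_le_one u v)
    (by linarith [Real.exp_pos (-|u - v|)])

/-- A product of two numbers in `[0, 1]` is at most either factor, so `(1 - exp (-r)) (1 - exp (-ε))
≤ 1 - exp (-min ε r)`. The regularized kernel thus has the same lower bound as the original,
whatever the cut-off parameters. -/
lemma mul_kernel_le_kernelReg {n ε₀ : ℝ} (μ' γ₀ a₁ : ℝ) (hn : 0 < n) (hε : 0 < ε₀) (u v : ℝ) :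
    n * (kernel 1 u v * (1 - Real.exp (-|u - v|))) ≤ kernelReg n ε₀ μ' γ₀ a₁ u v := by
  have hcut : 0 < cutoff ε₀ μ' γ₀ a₁ u v := mul_pos hε (Real.exp_pos _)
  unfold kernelReg
  rw [kernel_eq_mul n, mul_assoc]
  have hK := kernel_nonneg zero_le_one u v
  gcongr
  generalize cutoff ε₀ μ' γ₀ a₁ u v = ε at hcut
  have hr := abs_nonneg (u - v)
  generalize |u - v| = r at hr
  have h1 : Real.exp (-ε) < 1 := Real.exp_lt_one_iff.2 (by linarith)
  have h2 : Real.exp (-r) ≤ 1 := Real.exp_le_one_iff.2 (by linarith)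
  rw [le_div_iff₀ (by linarith)]
  rcases le_total ε r with h | h
  · rw [min_eq_left h]
    exact mul_le_of_le_one_left (by linarith) (by linarith [Real.exp_pos (-r)])
  · rw [min_eq_right h]
    exact mul_le_of_le_one_right (by linarith) (by linarith [Real.exp_pos (-ε)])

end Core

end ThreeWave

end

theorem theorem2p2 (n : ℝ) (hn : 0 < n) (α : ℝ≥0) (hα : 0 < α) (hα1 : α ≤ 1) :
    (∃ A : ThreeWave.H →ₗ.[ℂ] ThreeWave.H,
      ThreeWave.IsFriedrichsExtension (ThreeWave.coreL n α hα) A ∧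
      IsSelfAdjoint A ∧
      (∀ ψ : A.domain, 0 ≤ (inner ℂ (ψ : ThreeWave.H) (A ψ)).re) ∧
      (∀ ψ : ThreeWave.H, (ψ, (0 : ThreeWave.H)) ∈ A.graph ↔
        ∃ c : ℂ, ψ =ᵐ[ThreeWave.nu] fun _ => c) ∧
      ThreeWave.HasSpectralGap A ∧
      ∃ S : ℝ≥0 → ThreeWave.H →L[ℂ] ThreeWave.H,
        ThreeWave.IsContractionSemigroup S ∧ ThreeWave.IsGeneratedBy S A) ∧
    ∀ ε₀ μ' γ₀ a₁ : ℝ, 0 < ε₀ → 0 < μ' → 0 < γ₀ → 0 < a₁ →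
      ∃ A : ThreeWave.H →ₗ.[ℂ] ThreeWave.H,
        ThreeWave.IsFriedrichsExtension (ThreeWave.coreLReg n ε₀ μ' γ₀ a₁ α hα) A ∧
        IsSelfAdjoint A ∧
        (∀ ψ : A.domain, 0 ≤ (inner ℂ (ψ : ThreeWave.H) (A ψ)).re) ∧
        (∀ ψ : ThreeWave.H, (ψ, (0 : ThreeWave.H)) ∈ A.graph ↔
          ∃ c : ℂ, ψ =ᵐ[ThreeWave.nu] fun _ => c) ∧
        ThreeWave.HasSpectralGap A ∧
        ∃ S : ℝ≥0 → ThreeWave.H →L[ℂ] ThreeWave.H,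
          ThreeWave.IsContractionSemigroup S ∧ ThreeWave.IsGeneratedBy S A := by
  refine ⟨ThreeWave.exists_friedrichsExtension_coreOp _ _ (ThreeWave.kernel_comm n) hn
    (ThreeWave.mul_kernel_le_kernel hn) hα hα1, fun ε₀ μ' γ₀ a₁ hε _ _ _ => ?_⟩
  exact ThreeWave.exists_friedrichsExtension_coreOp _ _ (ThreeWave.kernelReg_comm n ε₀ μ' γ₀ a₁) hn
    (ThreeWave.mul_kernel_le_kernelReg μ' γ₀ a₁ hn hε) hα hα1
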